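/- Consider an infinite plane-strain cubic elastic body with moduli $\lambda,\mu,\mu^*\in\mathbb R$, $\mu>0$, $\lambda+\mu>0$, $\mu^*>0$, whose displacement $u=(u_1,u_2)$ under a body force $f=(f_1,f_2)$ is governed by $$(\lambda+2\mu)u_{1,11}+\mu^*u_{1,22}+(\lambda+\mu^*)u_{2,12}+f_1=0,\qquad (\lambda+2\mu)u_{2,22}+\mu^*u_{2,11}+(\lambda+\mu^*)u_{1,12}+f_2=0$$ in the sense of distributions on $\mathbb R^2$ (with $u$ locally integrable). Put $p=2\lambda\mu^*-4\mu(\lambda+\mu)$, $q=16\mu(\mu-\mu^*)(\lambda+\mu)(\lambda+\mu+\mu^*)$, $$s_{1,2}=\frac{\sqrt{-p\mp\sqrt q}}{\sqrt{2\mu^*(\lambda+2\mu)}},\quad Y^{(1)}_m=\frac{(\lambda+2\mu)s_m^2-\mu^*}{s_m},\quad Y^{(2)}_m=\frac{\mu^*s_m^2-(\lambda+2\mu)}{s_m},\quad r_m=\sqrt{x_1^2+s_m^2x_2^2},\quad \theta_m=\arctan\frac{s_mx_2}{x_1},$$ with principal (possibly complex) square roots, logarithm and arctangent, and with $\theta_2-\theta_1:=0$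 on $x_1=0$. Assume first $\mu^*\ne\mu$. (a) For every $P\in\mathbb R$ the fields $$u^{(P_1)}=\frac{P}{2\pi\sqrt q}\bigl(Y_1^{(1)}\log r_1-Y_2^{(1)}\log r_2,\ (\lambda+\mu^*)(\theta_2-\theta_1)\bigr),\qquad u^{(P_2)}=\frac{P}{2\pi\sqrt q}\bigl((\lambda+\mu^*)(\theta_2-\theta_1),\ Y_1^{(2)}\log r_1-Y_2^{(2)}\log r_2\bigr)$$ are real-valued and are displacement fields of the concentrated forces $f=(P\delta,0)$ and $f=(0,P\delta)$, respectively. (b) With $P=1$, superpose two unit force dipoles with arm parameter $d$: $$u^{(M)}(x_1,x_2;d)=u^{(P_1)}(x_1,x_2+\tfrac d4)-u^{(P_1)}(x_1,x_2-\tfrac d4)-u^{(P_2)}(x_1+\tfrac d4,x_2)+u^{(P_2)}(x_1-\tfrac d4,x_2).$$ For every $x\ne0$, $u^{(M)}(x;\cdot)$ is differentiable near $d=0$, and $\frac{\mathrm d}{\mathrm dd}u^{(M)}(x;d)\big|_{d=0}=\lim_{d\to0}\frac{\mathrm d}{\mathrm dd}u^{(M)}(x;d)=u(x)$, where $$u_1=-\frac{x_2}{4\pi\sqrt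 q}\Bigl((\lambda+\mu^*)\Bigl(\frac{s_1}{r_1^2}-\frac{s_2}{r_2^2}\Bigr)-\frac{(Y_1^{(1)}-Y_2^{(1)})s_1^2}{r_1^2}\Bigr)-\frac{Y_2^{(1)}}{4\pi\mu^*(\lambda+2\mu)}\,\frac{x_1^2x_2}{r_1^2r_2^2},$$ $$u_2=\frac{x_1}{4\pi\sqrt q}\Bigl(\frac{(\lambda+\mu^*)s_2+Y_2^{(2)}}{r_2^2}-\frac{(\lambda+\mu^*)s_1+Y_1^{(2)}}{r_1^2}\Bigr),$$ and both components are real. (c) This $u$ is a displacement field of the unit concentrated couple at the origin, i.e. it satisfies the equilibrium equations with $f=\tfrac12(\partial_2\delta,-\partial_1\delta)$. (d) For fixed $\lambda,\mu$ and $x\ne0$, as $\mu^*\to\mu$ (with $\mu^*\neq\mu$), $u(x)\to\dfrac{(-x_2,x_1)}{4\pi\mu r^2}$ with $r^2=x_1^2+x_2^2$, and this limit field is a displacement field of the unit concentrated couple in the isotropic material $\mu^*=\mu$. -/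

import Mathlib

open MeasureTheory Filter Topology
open scoped ContDiff

noncomputable section

namespace CubicCouple

/-! ### Material coefficients of a cubic material in plane strain

The moduli are `lam`, `mu` and `mus` (the second shear modulus). Complex square roots are principal;
for `mus > mu` the number `q` is negative and `s₁, s₂` (and likewise all quantities indexed by `m`)
are complex conjugates of each other. -/

/-- `p = 2 λ μ* - 4 μ (λ + μ)`. -/
def p (lam mu mus : ℝ) : ℝ := 2 * lam * mus - 4 * mu * (lam + mu)

/-- `q = 16 μ (μ - μ*) (λ + μ) (λ + μ + μ*)`. -/
def q (lam mu mus : ℝ) : ℝ := 16 * mu * (mu - mus) * (lam + mu) * (lam + mu + mus)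

/-- `√q`, the principal complex square root. -/
def sqrtq (lam mu mus : ℝ) : ℂ := (q lam mu mus : ℂ) ^ (1 / 2 : ℂ)

/-- `s₁ = √(-p - √q) / √(2 μ* (λ + 2 μ))`. -/
def s₁ (lam mu mus : ℝ) : ℂ :=
  (-(p lam mu mus : ℂ) - sqrtq lam mu mus) ^ (1 / 2 : ℂ) / (√(2 * mus * (lam + 2 * mu)) : ℝ)

/-- `s₂ = √(-p + √q) / √(2 μ* (λ + 2 μ))`. -/
def s₂ (lam mu mus : ℝ) : ℂ :=
  (-(p lam mu mus : ℂ) + sqrtq lam mu mus) ^ (1 / 2 : ℂ) / (√(2 * mus * (lam + 2 * mu)) : ℝ)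

/-- `Y⁽¹⁾ = ((λ + 2 μ) s² - μ*) / s`; insert `s = s₁` or `s = s₂`. -/
def Y1 (lam mu mus : ℝ) (s : ℂ) : ℂ := ((lam + 2 * mu) * s ^ 2 - mus) / s

/-- `Y⁽²⁾ = (μ* s² - (λ + 2 μ)) / s`; insert `s = s₁` or `s = s₂`. -/
def Y2 (lam mu mus : ℝ) (s : ℂ) : ℂ := (mus * s ^ 2 - (lam + 2 * mu)) / s

/-- `r_m² = x₁² + s_m² x₂²`. -/
def rsq (s : ℂ) (x : ℝ × ℝ) : ℂ := (x.1 : ℂ) ^ 2 + s ^ 2 * (x.2 : ℂ) ^ 2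

/-- `r_m = √(x₁² + s_m² x₂²)`. -/
def r (s : ℂ) (x : ℝ × ℝ) : ℂ := rsq s x ^ (1 / 2 : ℂ)

/-- `θ_m = arctan (s_m x₂ / x₁)`. Only the difference `θ₂ - θ₁` is used below; on the line `x₁ = 0`
both angles get the value `0` here, and so their difference gets the value `0`, which is the limit
of `θ₂ - θ₁` from either side of this line. -/
def θ (s : ℂ) (x : ℝ × ℝ) : ℂ := Complex.arctan (s * x.2 / x.1)

/-! ### Displacements due to a concentrated force at the origin -/

/-- First displacement component of the horizontal force `P`. -/
def forceH₁ (lam mu mus P : ℝ) (x : ℝ × ℝ) : ℂ :=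
  P / (2 * Real.pi * sqrtq lam mu mus) *
    (Y1 lam mu mus (s₁ lam mu mus) * Complex.log (r (s₁ lam mu mus) x)
      - Y1 lam mu mus (s₂ lam mu mus) * Complex.log (r (s₂ lam mu mus) x))

/-- Second displacement component of the horizontal force `P`. -/
def forceH₂ (lam mu mus P : ℝ) (x : ℝ × ℝ) : ℂ :=
  P * (lam + mus) / (2 * Real.pi * sqrtq lam mu mus) *
    (θ (s₂ lam mu mus) x - θ (s₁ lam mu mus) x)

/-- First displacement component of the vertical force `P`. -/
def forceV₁ (lam mu mus P : ℝ) (x : ℝ × ℝ) : ℂ :=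
  P * (lam + mus) / (2 * Real.pi * sqrtq lam mu mus) *
    (θ (s₂ lam mu mus) x - θ (s₁ lam mu mus) x)

/-- Second displacement component of the vertical force `P`. -/
def forceV₂ (lam mu mus P : ℝ) (x : ℝ × ℝ) : ℂ :=
  P / (2 * Real.pi * sqrtq lam mu mus) *
    (Y2 lam mu mus (s₁ lam mu mus) * Complex.log (r (s₁ lam mu mus) x)
      - Y2 lam mu mus (s₂ lam mu mus) * Complex.log (r (s₂ lam mu mus) x))

/-- The real displacement field of the horizontal force `P`. -/
def forceH (lam mu mus P : ℝ) (x : ℝ × ℝ) : ℝ × ℝ :=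
  ((forceH₁ lam mu mus P x).re, (forceH₂ lam mu mus P x).re)

/-- The real displacement field of the vertical force `P`. -/
def forceV (lam mu mus P : ℝ) (x : ℝ × ℝ) : ℝ × ℝ :=
  ((forceV₁ lam mu mus P x).re, (forceV₂ lam mu mus P x).re)

/-! ### The superposition of two force dipoles and the concentrated couple -/

/-- Superposition of two unit force dipoles with moment: horizontal forces `1` at `(0, -d/4)` and
`-1` at `(0, d/4)`, vertical forces `-1` at `(-d/4, 0)` and `1` at `(d/4, 0)`. -/
def dipoles (lam mu mus : ℝ) (x : ℝ × ℝ) (d : ℝ) : ℝ × ℝ :=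
  forceH lam mu mus 1 (x.1, x.2 + d / 4) - forceH lam mu mus 1 (x.1, x.2 - d / 4)
    - forceV lam mu mus 1 (x.1 + d / 4, x.2) + forceV lam mu mus 1 (x.1 - d / 4, x.2)

/-- First component of the explicit concentrated couple field. -/
def couple₁ (lam mu mus : ℝ) (x : ℝ × ℝ) : ℂ :=
  -(x.2 / (4 * Real.pi * sqrtq lam mu mus)) *
      ((lam + mus) * (s₁ lam mu mus / rsq (s₁ lam mu mus) x - s₂ lam mu mus / rsq (s₂ lam mu mus) x)
        - (Y1 lam mu mus (s₁ lam mu mus) - Y1 lam mu mus (s₂ lam mu mus)) * s₁ lam mu mus ^ 2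
            / rsq (s₁ lam mu mus) x)
    - Y1 lam mu mus (s₂ lam mu mus) / (4 * Real.pi * mus * (lam + 2 * mu)) *
        (x.1 ^ 2 * x.2 / (rsq (s₁ lam mu mus) x * rsq (s₂ lam mu mus) x))

/-- Second component of the explicit concentrated couple field. -/
def couple₂ (lam mu mus : ℝ) (x : ℝ × ℝ) : ℂ :=
  x.1 / (4 * Real.pi * sqrtq lam mu mus) *
    (((lam + mus) * s₂ lam mu mus + Y2 lam mu mus (s₂ lam mu mus)) / rsq (s₂ lam mu mus) x
      - ((lam + mus) * s₁ lam mu mus + Y2 lam mu mus (s₁ lam mu mus)) / rsq (s₁ lam mu mus) x)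

/-- The real concentrated couple field. -/
def couple (lam mu mus : ℝ) (x : ℝ × ℝ) : ℝ × ℝ :=
  ((couple₁ lam mu mus x).re, (couple₂ lam mu mus x).re)

/-- The isotropic concentrated couple field `(-x₂, x₁) / (4 π μ r²)`. -/
def isoCouple (mu : ℝ) (x : ℝ × ℝ) : ℝ × ℝ :=
  (-x.2 / (4 * Real.pi * mu * (x.1 ^ 2 + x.2 ^ 2)),
    x.1 / (4 * Real.pi * mu * (x.1 ^ 2 + x.2 ^ 2)))

/-! ### Equilibrium in the sense of distributions -/

/-- Partial derivative `∂/∂x₁`. -/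
def D₁ (φ : ℝ × ℝ → ℝ) (x : ℝ × ℝ) : ℝ := fderiv ℝ φ x (1, 0)

/-- Partial derivative `∂/∂x₂`. -/
def D₂ (φ : ℝ × ℝ → ℝ) (x : ℝ × ℝ) : ℝ := fderiv ℝ φ x (0, 1)

/-- The displacement `u` of the infinite body satisfies, in the sense of distributions on the plane,
`(λ+2μ) u₁,₁₁ + μ* u₁,₂₂ + (λ+μ*) u₂,₁₂ + f₁ = 0` and
`(λ+2μ) u₂,₂₂ + μ* u₂,₁₁ + (λ+μ*) u₁,₁₂ + f₂ = 0`,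
where the body force `(f₁, f₂)` is given by its action on test functions. -/
def IsEquilibrium (lam mu mus : ℝ) (u : ℝ × ℝ → ℝ × ℝ) (f₁ f₂ : (ℝ × ℝ → ℝ) → ℝ) : Prop :=
  LocallyIntegrable (fun x => (u x).1) ∧ LocallyIntegrable (fun x => (u x).2) ∧
  ∀ φ : ℝ × ℝ → ℝ, ContDiff ℝ ∞ φ → HasCompactSupport φ →
    (∫ x, ((u x).1 * ((lam + 2 * mu) * D₁ (D₁ φ) x + mus * D₂ (D₂ φ) x)
        + (u x).2 * ((lam + mus) * D₁ (D₂ φ) x))) + f₁ φ = 0 ∧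
    (∫ x, ((u x).2 * ((lam + 2 * mu) * D₂ (D₂ φ) x + mus * D₁ (D₁ φ) x)
        + (u x).1 * ((lam + mus) * D₁ (D₂ φ) x))) + f₂ φ = 0

/-- `u` is a displacement field of the infinite body under the concentrated force `(P₁, P₂) δ`. -/
def IsForceSolution (lam mu mus P₁ P₂ : ℝ) (u : ℝ × ℝ → ℝ × ℝ) : Prop :=
  IsEquilibrium lam mu mus u (fun φ => P₁ * φ 0) (fun φ => P₂ * φ 0)

/-- `u` is a displacement field of the infinite body under the concentrated couple of unit strength
at the origin, that is, under the body force `f = (1/2) (∂₂ δ, -∂₁ δ)`, whose resultant is `0` and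
whose moment `⟨f₂, x₁⟩ - ⟨f₁, x₂⟩` is `1`. It is the linear term in `d` of the four point forces
in `dipoles`. -/
def IsUnitCoupleSolution (lam mu mus : ℝ) (u : ℝ × ℝ → ℝ × ℝ) : Prop :=
  IsEquilibrium lam mu mus u (fun φ => -(1 / 2) * D₂ φ 0) (fun φ => (1 / 2) * D₁ φ 0)

end CubicCouple

end

/-!
With `C = λ + 2 μ` and `k = λ + μ*`, the operator of the equilibrium equations has determinant
`(C a² + μ* b²) (C b² + μ* a²) - k² a² b² = C μ* (s₁² a² + b²) (s₂² a² + b²)`. Its characteristic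
roots `s₁, s₂` lie in the right half-plane, have product `1`, and are both real (`μ* < μ`) or
complex conjugates of each other (`μ* > μ`); in the second case conjugation also changes the sign of
`√q`. All fields are therefore real.

For a root `s` put `K₁ = x₁ / r²` and `K₂ = x₂ / r²`. The force fields are built from `log r`, with
gradient `(K₁, s² K₂)`, and from `θ₂ - θ₁`, whose gradient is the difference between the values of
`(-s K₂, s K₁)` at `s₂` and at `s₁`. The angle difference is smooth away from the origin because, by
the addition theorem and `s₁ s₂ = 1`, it is the single arctangent of `(s₂ - s₁) x₁ x₂ / (x₁² + x₂²)`
(`θ_sub_θ`). Integration by parts on almost every coordinate line shows that these pointwise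
gradients are weak gradients (`integral_mul_D₁`, `integral_mul_D₂`). Hence all second derivatives
are governed by two identities: the distributional symmetry `∂₂ K₁ = s² ∂₁ K₂`
(`integral_K₁_mul_D₂`), and the flux `∂₁ K₁ + ∂₂ K₂ = (2 π / s) δ`
(`integral_K₁_mul_D₁_add_K₂_mul_D₂`). The latter is computed in polar coordinates from
`∫ dt / (cos² t + s² sin² t) = 2 π / s` over a period, which holds for complex `s` with positive
real part.

With these two identities the equilibrium equations reduce to polynomial identities modulo
`s₁ s₂ = 1` and Vieta's formula (`s₁_sq_add_s₂_sq`); the strengths of the point sources come from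
`C μ* (s₁² - s₂²) = -√q`. The couple field is `½ (∂₂ u^(P₁) - ∂₁ u^(P₂))`, a combination of the
kernels `K₁, K₂`, and is treated in the same way. Dividing out `s₁ - s₂` writes it in terms of the
symmetric functions `s₁ + s₂` and `s₁² + s₂²` (`couple_eq_coupleReal`), which are real and
continuous in `μ*` up to `μ* = μ`; this gives the isotropic limit.
-/

noncomputable section

namespace CubicCouple

/-! ### Test functions and partial derivatives -/

/-- A smooth compactly supported real function on the plane. -/
def IsTest (φ : ℝ × ℝ → ℝ) : Prop := ContDiff ℝ ∞ φ ∧ HasCompactSupport φ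

theorem IsTest.isTest_D₁ {φ : ℝ × ℝ → ℝ} (h : IsTest φ) : IsTest (D₁ φ) :=
  ⟨(h.1.fderiv_right (m := ∞) (by simp)).clm_apply contDiff_const, h.2.fderiv_apply ℝ _⟩

theorem IsTest.isTest_D₂ {φ : ℝ × ℝ → ℝ} (h : IsTest φ) : IsTest (D₂ φ) :=
  ⟨(h.1.fderiv_right (m := ∞) (by simp)).clm_apply contDiff_const, h.2.fderiv_apply ℝ _⟩

theorem IsTest.continuous {φ : ℝ × ℝ → ℝ} (h : IsTest φ) : Continuous φ := h.1.continuous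

theorem IsTest.hasFDerivAt {φ : ℝ × ℝ → ℝ} (h : IsTest φ) (x : ℝ × ℝ) :
    HasFDerivAt φ (fderiv ℝ φ x) x :=
  (h.1.differentiable (by simp) x).hasFDerivAt

theorem IsTest.D₁_D₂ {φ : ℝ × ℝ → ℝ} (h : IsTest φ) (x : ℝ × ℝ) :
    D₁ (D₂ φ) x = D₂ (D₁ φ) x := by
  have hd : DifferentiableAt ℝ (fderiv ℝ φ) x :=
    (h.1.fderiv_right (m := ∞) (by simp)).differentiable (by simp) x
  have hs : IsSymmSndFDerivAt ℝ φ x := h.1.contDiffAt.isSymmSndFDerivAt (by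
    simp only [minSmoothness_of_isRCLikeNormedField]
    exact WithTop.coe_le_coe.2 (le_top : (2 : ℕ∞) ≤ ⊤))
  have key : ∀ v w : ℝ × ℝ,
      fderiv ℝ (fun y => fderiv ℝ φ y v) x w = fderiv ℝ (fderiv ℝ φ) x w v := by
    intro v w
    rw [fderiv_clm_apply hd (differentiableAt_const v)]
    simp
  exact (key _ _).trans ((hs.eq _ _).trans (key _ _).symm)

theorem IsTest.hasDerivAt_line {φ : ℝ × ℝ → ℝ} (h : IsTest φ) {c : ℝ → ℝ × ℝ} {v : ℝ × ℝ} {t : ℝ}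
    (hc : HasDerivAt c v t) :
    HasDerivAt (fun τ => φ (c τ)) (v.1 * D₁ φ (c t) + v.2 * D₂ φ (c t)) t := by
  have := (h.hasFDerivAt (c t)).comp_hasDerivAt t hc
  convert! this using 1
  have hv : v = v.1 • ((1 : ℝ), (0 : ℝ)) + v.2 • ((0 : ℝ), (1 : ℝ)) := by ext <;> simp
  conv_rhs => rw [hv]
  rw [map_add, map_smul, map_smul]
  rfl

theorem IsTest.integrable_mul {φ : ℝ × ℝ → ℝ} (h : IsTest φ) {F : ℝ × ℝ → ℂ}
    (hF : LocallyIntegrable F) : Integrable (fun x => F x * (φ x : ℂ)) := by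
  have hc : HasCompactSupport (fun x => (φ x : ℂ)) :=
    h.2.comp_left (g := fun t : ℝ => (t : ℂ)) (by simp)
  have := hF.integrable_smul_left_of_hasCompactSupport
    (g := fun x => (φ x : ℂ)) (Complex.continuous_ofReal.comp h.continuous) hc
  simpa [mul_comm] using this

/-! ### Local integrability of functions with a singularity at the origin -/

theorem integrableOn_ball_norm_inv_add_norm (R : ℝ) :
    IntegrableOn (fun x : ℝ × ℝ => ‖x‖⁻¹ + ‖x‖) (Metric.ball 0 R) := by
  refine (integrableOn_fun_norm_addHaar (volume : Measure (ℝ × ℝ)) (f := fun y => y⁻¹ + y)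
    (r := R)).2 ?_
  have h : IntegrableOn (fun y : ℝ => 1 + y ^ 2) (Set.Ioo 0 R) :=
    ((by fun_prop : Continuous fun y : ℝ => 1 + y ^ 2).continuousOn.integrableOn_compact
      (isCompact_Icc (a := 0) (b := R))).mono_set Set.Ioo_subset_Icc_self
  refine h.congr_fun (fun y hy => ?_) measurableSet_Ioo
  have : y ≠ 0 := hy.1.ne'
  simp
  field_simp

/-- A function that is continuous away from the origin and grows in a controlled way along rays is
locally integrable on the plane. The growth condition covers functions that are homogeneous of
degree `0` or `-1`, and logarithms of homogeneous functions. -/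
theorem locallyIntegrable_of_ray_bound {F : ℝ × ℝ → ℂ} (hc : ContinuousOn F {0}ᶜ)
    (hb : ∀ t : ℝ, 0 < t → ∀ y : ℝ × ℝ, y ≠ 0 → ‖F (t • y)‖ ≤ (‖F y‖ + 1) * (t + t⁻¹)) :
    LocallyIntegrable F := by
  obtain ⟨K, hK⟩ : ∃ K, ∀ y ∈ Metric.sphere (0 : ℝ × ℝ) 1, ‖F y‖ ≤ K :=
    (isCompact_sphere (0 : ℝ × ℝ) 1).exists_bound_of_continuousOn
      (hc.mono fun y hy => by
        simp only [Set.mem_compl_iff, Set.mem_singleton_iff]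
        rintro rfl
        simp at hy)
  have hm : AEStronglyMeasurable F := by
    have := hc.aestronglyMeasurable (μ := volume) (measurableSet_singleton (0 : ℝ × ℝ)).compl
    rwa [restrict_compl_singleton] at this
  have hbd : ∀ x : ℝ × ℝ, x ≠ 0 → ‖F x‖ ≤ (K + 1) * (‖x‖⁻¹ + ‖x‖) := by
    intro x hx
    have hn : 0 < ‖x‖ := norm_pos_iff.2 hx
    have hy : ‖(‖x‖⁻¹ • x)‖ = 1 := by
      rw [norm_smul, norm_inv, norm_norm, inv_mul_cancel₀ hn.ne']
    have hy0 : ‖x‖⁻¹ • x ≠ 0 := norm_ne_zero_iff.1 (by rw [hy]; exact one_ne_zero)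
    have h1 := hb ‖x‖ hn _ hy0
    rw [smul_smul, mul_inv_cancel₀ hn.ne', one_smul] at h1
    refine h1.trans ?_
    rw [add_comm ‖x‖]
    gcongr
    exact hK _ (by simpa using hy)
  intro x
  refine ⟨Metric.ball 0 (‖x‖ + 1), Metric.isOpen_ball.mem_nhds (by simp), ?_⟩
  refine ((integrableOn_ball_norm_inv_add_norm (‖x‖ + 1)).const_mul (K + 1)).mono' hm.restrict ?_
  refine ae_restrict_of_ae ?_
  filter_upwards [compl_mem_ae_iff.2 (measure_singleton (0 : ℝ × ℝ))] with y hy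
  exact hbd y hy

/-! ### Weak derivatives of functions that are differentiable away from the origin -/

theorem integral_line_deriv_eq_zero {f g : ℝ → ℂ} {ψ ψ' : ℝ → ℝ}
    (hf : ∀ t, HasDerivAt f (g t) t) (hψ : ∀ t, HasDerivAt ψ (ψ' t) t)
    (hs : HasCompactSupport ψ) (hi : Integrable fun t => f t * (ψ' t : ℂ) + g t * (ψ t : ℂ)) :
    ∫ t, (f t * (ψ' t : ℂ) + g t * (ψ t : ℂ)) = 0 := by
  have hd : ∀ t, HasDerivAt (fun t => f t * (ψ t : ℂ)) (f t * (ψ' t : ℂ) + g t * (ψ t : ℂ)) t := by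
    intro t
    convert! (hf t).mul (hψ t).ofReal_comp using 1
    ring
  have hcs : HasCompactSupport (fun t => f t * (ψ t : ℂ)) :=
    (hs.comp_left (g := fun t : ℝ => (t : ℂ)) (by simp)).mul_left
  have hcont : Continuous (fun t => f t * (ψ t : ℂ)) :=
    continuous_iff_continuousAt.2 fun t => (hd t).continuousAt
  exact integral_eq_zero_of_hasDerivAt_of_integrable hd hi
    (hcont.integrable_of_hasCompactSupport hcs)

theorem hasCompactSupport_comp_fst {φ : ℝ × ℝ → ℝ} (h : HasCompactSupport φ) (b : ℝ) :
    HasCompactSupport fun t => φ (t, b) := by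
  refine HasCompactSupport.intro (h.isCompact.image continuous_fst) fun t ht => ?_
  exact image_eq_zero_of_notMem_tsupport fun h' => ht ⟨_, h', rfl⟩

theorem hasCompactSupport_comp_snd {φ : ℝ × ℝ → ℝ} (h : HasCompactSupport φ) (a : ℝ) :
    HasCompactSupport fun t => φ (a, t) := by
  refine HasCompactSupport.intro (h.isCompact.image continuous_snd) fun t ht => ?_
  exact image_eq_zero_of_notMem_tsupport fun h' => ht ⟨_, h', rfl⟩

/-- The pointwise derivative is the weak derivative. Almost every horizontal line misses the origin,
and there `F φ` is differentiable with compact support, so that its derivative integrates to `0`. -/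
theorem integral_mul_D₁ {F G : ℝ × ℝ → ℂ} (hF : LocallyIntegrable F) (hG : LocallyIntegrable G)
    (hd : ∀ x : ℝ × ℝ, x ≠ 0 → HasDerivAt (fun t => F (t, x.2)) (G x) x.1)
    {φ : ℝ × ℝ → ℝ} (h : IsTest φ) :
    ∫ x, F x * (D₁ φ x : ℂ) = -∫ x, G x * (φ x : ℂ) := by
  have i1 := h.isTest_D₁.integrable_mul hF
  have i2 := h.integrable_mul hG
  rw [eq_neg_iff_add_eq_zero, ← integral_add i1 i2]
  have i3 : Integrable fun x => F x * (D₁ φ x : ℂ) + G x * (φ x : ℂ) := i1.add i2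
  rw [Measure.volume_eq_prod] at i3 ⊢
  rw [integral_prod_symm _ i3]
  refine integral_eq_zero_of_ae ?_
  filter_upwards [i3.prod_left_ae, compl_mem_ae_iff.2 (measure_singleton (0 : ℝ))] with b hb hb0
  refine integral_line_deriv_eq_zero (f := fun t => F (t, b)) (g := fun t => G (t, b))
    (ψ := fun t => φ (t, b)) (ψ' := fun t => D₁ φ (t, b))
    (fun t => hd (t, b) fun h0 => hb0 (congrArg Prod.snd h0)) (fun t => ?_)
    (hasCompactSupport_comp_fst h.2 b) hb
  simpa using h.hasDerivAt_line ((hasDerivAt_id t).prodMk (hasDerivAt_const t b))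

/-- The analogue of `integral_mul_D₁` on vertical lines. -/
theorem integral_mul_D₂ {F G : ℝ × ℝ → ℂ} (hF : LocallyIntegrable F) (hG : LocallyIntegrable G)
    (hd : ∀ x : ℝ × ℝ, x ≠ 0 → HasDerivAt (fun t => F (x.1, t)) (G x) x.2)
    {φ : ℝ × ℝ → ℝ} (h : IsTest φ) :
    ∫ x, F x * (D₂ φ x : ℂ) = -∫ x, G x * (φ x : ℂ) := by
  have i1 := h.isTest_D₂.integrable_mul hF
  have i2 := h.integrable_mul hG
  rw [eq_neg_iff_add_eq_zero, ← integral_add i1 i2]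
  have i3 : Integrable fun x => F x * (D₂ φ x : ℂ) + G x * (φ x : ℂ) := i1.add i2
  rw [Measure.volume_eq_prod] at i3 ⊢
  rw [integral_prod _ i3]
  refine integral_eq_zero_of_ae ?_
  filter_upwards [i3.prod_right_ae, compl_mem_ae_iff.2 (measure_singleton (0 : ℝ))] with a ha ha0
  refine integral_line_deriv_eq_zero (f := fun t => F (a, t)) (g := fun t => G (a, t))
    (ψ := fun t => φ (a, t)) (ψ' := fun t => D₂ φ (a, t))
    (fun t => hd (a, t) fun h0 => ha0 (congrArg Prod.fst h0)) (fun t => ?_)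
    (hasCompactSupport_comp_snd h.2 a) ha
  simpa using h.hasDerivAt_line ((hasDerivAt_const t a).prodMk (hasDerivAt_id t))

/-! ### The logarithmic potential of a characteristic root and its gradient -/

/-- The value of `r²` stays off the branch cut of the logarithm because `Re s > 0`. -/
theorem rsq_mem_slitPlane {s : ℂ} (hs : 0 < s.re) {x : ℝ × ℝ} (hx : x ≠ 0) :
    rsq s x ∈ Complex.slitPlane := by
  have hre : (rsq s x).re = x.1 ^ 2 + (s.re ^ 2 - s.im ^ 2) * x.2 ^ 2 := by
    simp only [rsq, pow_two, Complex.add_re, Complex.mul_re, Complex.mul_im, Complex.ofReal_re,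
      Complex.ofReal_im]
    ring
  have him : (rsq s x).im = 2 * s.re * s.im * x.2 ^ 2 := by
    simp only [rsq, pow_two, Complex.add_im, Complex.mul_re, Complex.mul_im, Complex.ofReal_re,
      Complex.ofReal_im]
    ring
  rw [Complex.mem_slitPlane_iff, hre, him]
  by_cases h2 : x.2 = 0
  · have h1 : x.1 ≠ 0 := fun h1 => hx (Prod.ext h1 h2)
    left
    rw [h2]
    have : 0 < x.1 ^ 2 := by positivity
    linarith
  by_cases hi : s.im = 0
  · left
    rw [hi]
    have : 0 < s.re ^ 2 * x.2 ^ 2 := by positivity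
    nlinarith [sq_nonneg x.1]
  · right
    positivity

theorem rsq_ne_zero {s : ℂ} (hs : 0 < s.re) {x : ℝ × ℝ} (hx : x ≠ 0) : rsq s x ≠ 0 :=
  Complex.slitPlane_ne_zero (rsq_mem_slitPlane hs hx)

theorem rsq_smul (s : ℂ) (t : ℝ) (x : ℝ × ℝ) : rsq s (t • x) = ((t ^ 2 : ℝ) : ℂ) * rsq s x := by
  simp [rsq]; ring

theorem continuous_rsq (s : ℂ) : Continuous (rsq s) := by
  unfold rsq; fun_prop

/-- The argument of `√z` is half that of `z`, so the principal branches are compatible. Where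
`rsq s x = 0`, both sides are the junk value `0`. -/
theorem log_r (s : ℂ) (x : ℝ × ℝ) : Complex.log (r s x) = Complex.log (rsq s x) / 2 := by
  unfold r
  by_cases h : rsq s x = 0
  · simp [h]
  rw [Complex.cpow_def_of_ne_zero h]
  have h1 := Complex.neg_pi_lt_log_im (rsq s x)
  have h2 := Complex.log_im_le_pi (rsq s x)
  have him : (Complex.log (rsq s x) * (1 / 2)).im = (Complex.log (rsq s x)).im / 2 := by
    rw [show (1 / 2 : ℂ) = ((1 / 2 : ℝ) : ℂ) by push_cast; rfl, Complex.im_mul_ofReal]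
    ring
  rw [Complex.log_exp (by rw [him]; linarith [Real.pi_pos]) (by rw [him]; linarith [Real.pi_pos])]
  ring

/-- `K₁ s = ∂₁ log r` for the distance function `r` of the characteristic root `s`. -/
def K₁ (s : ℂ) (x : ℝ × ℝ) : ℂ := x.1 / rsq s x

/-- `s² K₂ s = ∂₂ log r` for the distance function `r` of the characteristic root `s`. -/
def K₂ (s : ℂ) (x : ℝ × ℝ) : ℂ := x.2 / rsq s x

theorem hasDerivAt_rsq_fst (s : ℂ) (x : ℝ × ℝ) :
    HasDerivAt (fun t : ℝ => rsq s (t, x.2)) (2 * x.1) x.1 := by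
  unfold rsq
  have h := ((Complex.ofRealCLM.hasDerivAt (x := x.1)).pow 2).add_const (s ^ 2 * (x.2 : ℂ) ^ 2)
  simpa using h

theorem hasDerivAt_rsq_snd (s : ℂ) (x : ℝ × ℝ) :
    HasDerivAt (fun t : ℝ => rsq s (x.1, t)) (2 * s ^ 2 * x.2) x.2 := by
  unfold rsq
  have h := (((Complex.ofRealCLM.hasDerivAt (x := x.2)).pow 2).const_mul (s ^ 2)).const_add
    ((x.1 : ℂ) ^ 2)
  convert! h using 1
  simp; ring

theorem hasDerivAt_log_r_fst {s : ℂ} (hs : 0 < s.re) {x : ℝ × ℝ} (hx : x ≠ 0) :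
    HasDerivAt (fun t : ℝ => Complex.log (r s (t, x.2))) (K₁ s x) x.1 := by
  simp only [log_r]
  convert! ((hasDerivAt_rsq_fst s x).clog_real (rsq_mem_slitPlane hs hx)).div_const 2 using 1
  simp only [K₁, Prod.mk.eta]
  ring

theorem hasDerivAt_log_r_snd {s : ℂ} (hs : 0 < s.re) {x : ℝ × ℝ} (hx : x ≠ 0) :
    HasDerivAt (fun t : ℝ => Complex.log (r s (x.1, t))) (s ^ 2 * K₂ s x) x.2 := by
  simp only [log_r]
  convert! ((hasDerivAt_rsq_snd s x).clog_real (rsq_mem_slitPlane hs hx)).div_const 2 using 1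
  simp only [K₂, Prod.mk.eta]
  ring

theorem continuousAt_K₁ {s : ℂ} (hs : 0 < s.re) {x : ℝ × ℝ} (hx : x ≠ 0) :
    ContinuousAt (K₁ s) x :=
  ContinuousAt.div (by fun_prop) (continuous_rsq s).continuousAt (rsq_ne_zero hs hx)

theorem continuousAt_K₂ {s : ℂ} (hs : 0 < s.re) {x : ℝ × ℝ} (hx : x ≠ 0) :
    ContinuousAt (K₂ s) x :=
  ContinuousAt.div (by fun_prop) (continuous_rsq s).continuousAt (rsq_ne_zero hs hx)

theorem one_le_add_inv {t : ℝ} (ht : 0 < t) : 1 ≤ t + t⁻¹ := by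
  rcases le_total 1 t with h | h
  · linarith [inv_pos.2 ht]
  · linarith [(one_le_inv₀ ht).2 h]

theorem locallyIntegrable_of_homogeneous_neg_one {F : ℝ × ℝ → ℂ} (hc : ContinuousOn F {0}ᶜ)
    (hh : ∀ t : ℝ, 0 < t → ∀ y : ℝ × ℝ, F (t • y) = ((t⁻¹ : ℝ) : ℂ) * F y) :
    LocallyIntegrable F := by
  refine locallyIntegrable_of_ray_bound hc fun t ht y _ => ?_
  rw [hh t ht y, norm_mul, Complex.norm_real, Real.norm_of_nonneg (inv_pos.2 ht).le, mul_comm]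
  gcongr
  · linarith
  · linarith

theorem locallyIntegrable_K₁ {s : ℂ} (hs : 0 < s.re) : LocallyIntegrable (K₁ s) := by
  refine locallyIntegrable_of_homogeneous_neg_one
    (fun x hx => (continuousAt_K₁ hs hx).continuousWithinAt) fun t ht y => ?_
  have : (t : ℂ) ≠ 0 := by exact_mod_cast ht.ne'
  simp only [K₁, rsq_smul, Prod.smul_fst, smul_eq_mul]
  push_cast
  field_simp

theorem locallyIntegrable_K₂ {s : ℂ} (hs : 0 < s.re) : LocallyIntegrable (K₂ s) := by
  refine locallyIntegrable_of_homogeneous_neg_one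
    (fun x hx => (continuousAt_K₂ hs hx).continuousWithinAt) fun t ht y => ?_
  have : (t : ℂ) ≠ 0 := by exact_mod_cast ht.ne'
  simp only [K₂, rsq_smul, Prod.smul_snd, smul_eq_mul]
  push_cast
  field_simp

theorem locallyIntegrable_log_r {s : ℂ} (hs : 0 < s.re) :
    LocallyIntegrable fun x => Complex.log (r s x) := by
  simp only [log_r]
  refine locallyIntegrable_of_ray_bound (fun x hx => ContinuousAt.continuousWithinAt ?_)
    fun t ht y hy => ?_
  · exact ((continuous_rsq s).continuousAt.clog (rsq_mem_slitPlane hs hx)).div_const 2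
  · rw [rsq_smul, Complex.log_ofReal_mul (by positivity) (rsq_ne_zero hs hy), Real.log_pow]
    have h1 : ((((2 : ℕ) : ℝ) * Real.log t : ℝ) + Complex.log (rsq s y)) / 2
        = (Real.log t : ℂ) + Complex.log (rsq s y) / 2 := by push_cast; ring
    rw [h1]
    refine (norm_add_le _ _).trans ?_
    have h2 : ‖(Real.log t : ℂ)‖ ≤ t + t⁻¹ := by
      rw [Complex.norm_real, Real.norm_eq_abs, abs_le]
      have h3 := Real.log_le_sub_one_of_pos ht
      have h4 := Real.log_le_sub_one_of_pos (inv_pos.2 ht)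
      rw [Real.log_inv] at h4
      have := inv_pos.2 ht
      constructor <;> linarith
    have h5 : ‖Complex.log (rsq s y) / 2‖ ≤ ‖Complex.log (rsq s y) / 2‖ * (t + t⁻¹) :=
      le_mul_of_one_le_right (norm_nonneg _) (one_le_add_inv ht)
    linarith

theorem integral_log_r_mul_D₁ {s : ℂ} (hs : 0 < s.re) {φ : ℝ × ℝ → ℝ} (h : IsTest φ) :
    ∫ x, Complex.log (r s x) * (D₁ φ x : ℂ) = -∫ x, K₁ s x * (φ x : ℂ) :=
  integral_mul_D₁ (locallyIntegrable_log_r hs) (locallyIntegrable_K₁ hs)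
    (fun _ hx => hasDerivAt_log_r_fst hs hx) h

theorem integral_log_r_mul_D₂ {s : ℂ} (hs : 0 < s.re) {φ : ℝ × ℝ → ℝ} (h : IsTest φ) :
    ∫ x, Complex.log (r s x) * (D₂ φ x : ℂ) = -(s ^ 2 * ∫ x, K₂ s x * (φ x : ℂ)) := by
  rw [integral_mul_D₂ (G := fun x => s ^ 2 * K₂ s x) (locallyIntegrable_log_r hs)
    ((locallyIntegrable_K₂ hs).smul (s ^ 2)) (fun _ hx => hasDerivAt_log_r_snd hs hx) h,
    ← integral_const_mul]
  simp only [mul_assoc]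

/-- The relation `∂₂ K₁ = s² ∂₁ K₂` carries no point source, since both sides are the mixed second
derivative of the locally integrable function `log r`. -/
theorem integral_K₁_mul_D₂ {s : ℂ} (hs : 0 < s.re) {φ : ℝ × ℝ → ℝ} (h : IsTest φ) :
    ∫ x, K₁ s x * (D₂ φ x : ℂ) = s ^ 2 * ∫ x, K₂ s x * (D₁ φ x : ℂ) := by
  have h1 := integral_log_r_mul_D₁ hs h.isTest_D₂
  have h2 := integral_log_r_mul_D₂ hs h.isTest_D₁
  simp only [h.D₁_D₂] at h1
  exact neg_injective (h1.symm.trans h2)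

/-! ### The flux of the gradient through the origin -/

theorem cos_sin_ne_zero (t : ℝ) : ((Real.cos t, Real.sin t) : ℝ × ℝ) ≠ 0 := by
  intro h
  have h1 : Real.cos t = 0 := congrArg Prod.fst h
  have h2 : Real.sin t = 0 := congrArg Prod.snd h
  have := Real.cos_sq_add_sin_sq t
  rw [h1, h2] at this
  norm_num at this

theorem norm_one_sub_div_one_add_lt_one {s : ℂ} (hs : 0 < s.re) : ‖(1 - s) / (1 + s)‖ < 1 := by
  have h0 : 0 < ‖1 + s‖ := norm_pos_iff.2 fun h => by
    have := congrArg Complex.re h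
    simp at this; linarith
  rw [norm_div, div_lt_one h0]
  refine lt_of_pow_lt_pow_left₀ 2 h0.le ?_
  rw [← Complex.normSq_eq_norm_sq, ← Complex.normSq_eq_norm_sq, Complex.normSq_apply,
    Complex.normSq_apply]
  simp
  nlinarith

/-- The derivative of the antiderivative used in `integral_inv_rsq_cos_sin`, with
`e = exp (-2 i t)`, `f = exp (2 i t)` and `g = cos² t + s² sin² t`. -/
theorem inv_eq_of_angle_parameter {s κ e f g : ℂ} (hκ : κ * (1 + s) = 1 - s) (hef : e * f = 1)
    (hg : 4 * g = 2 + e + f + s ^ 2 * (2 - e - f)) (n1 : 1 + κ * e ≠ 0) (n2 : 1 + κ * f ≠ 0)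
    (hs0 : s ≠ 0) (hs1 : 1 + s ≠ 0) :
    g⁻¹ = s⁻¹ * (1 + (2 * Complex.I)⁻¹ * (κ * (-2 * Complex.I * e) / (1 + κ * e)
      - κ * (2 * Complex.I * f) / (1 + κ * f))) := by
  have hI := Complex.I_ne_zero
  have hp : (1 + κ * e) * (1 + κ * f) * (1 + s) ^ 2 = 4 * g := by
    have : (1 + κ * e) * (1 + κ * f) * (1 + s) ^ 2
        = (1 + s + κ * (1 + s) * e) * (1 + s + κ * (1 + s) * f) := by ring
    rw [this, hκ]
    linear_combination (1 - s) ^ 2 * hef - hg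
  have h1 : (2 * Complex.I)⁻¹ * (κ * (-2 * Complex.I * e) / (1 + κ * e)
      - κ * (2 * Complex.I * f) / (1 + κ * f)) = -(κ * e / (1 + κ * e)) - κ * f / (1 + κ * f) := by
    field_simp
  have h2 : 1 + (-(κ * e / (1 + κ * e)) - κ * f / (1 + κ * f))
      = (1 - κ ^ 2) / ((1 + κ * e) * (1 + κ * f)) := by
    field_simp
    linear_combination -κ ^ 2 * hef
  have h3 : (1 - κ ^ 2) * (1 + s) ^ 2 = 4 * s := by
    linear_combination (-(κ * (1 + s)) - (1 - s)) * hκ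
  rw [h1, h2, inv_eq_iff_eq_inv, mul_inv, inv_inv, inv_div, mul_div_assoc', eq_div_iff]
  · refine mul_right_cancel₀ (pow_ne_zero 2 hs1) ?_
    linear_combination g * h3 - s * hp
  · intro h
    rw [h, zero_mul] at h3
    exact hs0 (by linear_combination -(1 / 4 : ℂ) * h3)

/-- The antiderivative is the angle `arctan (s tan t)`, continued smoothly across the poles of the
tangent: `cos t + i s sin t = ½ (1 + s) exp (i t) (1 + κ exp (-2 i t))` with
`κ = (1 - s) / (1 + s)`, where `|κ| < 1`. -/
theorem integral_inv_rsq_cos_sin {s : ℂ} (hs : 0 < s.re) :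
    ∫ t in (-Real.pi)..Real.pi, (rsq s (Real.cos t, Real.sin t))⁻¹ = 2 * Real.pi / s := by
  have hs0 : s ≠ 0 := fun h => by simp [h] at hs
  have hs1 : 1 + s ≠ 0 := fun h => by
    have := congrArg Complex.re h
    simp at this; linarith
  set κ : ℂ := (1 - s) / (1 + s) with hκ
  have hn : ‖κ‖ < 1 := norm_one_sub_div_one_add_lt_one hs
  have hslit : ∀ y : ℝ, 1 + κ * Complex.exp ((y : ℂ) * Complex.I) ∈ Complex.slitPlane := by
    intro y
    refine Complex.mem_slitPlane_of_norm_lt_one ?_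
    rw [norm_mul, Complex.norm_exp_ofReal_mul_I, mul_one]
    exact hn
  have hE : ∀ (c t : ℝ), HasDerivAt
      (fun t : ℝ => 1 + κ * Complex.exp (((c * t : ℝ) : ℂ) * Complex.I))
      (κ * (c * Complex.I * Complex.exp (((c * t : ℝ) : ℂ) * Complex.I))) t := by
    intro c t
    have h1 : HasDerivAt (fun t : ℝ => ((c * t : ℝ) : ℂ) * Complex.I) (c * Complex.I) t := by
      have := (((hasDerivAt_id t).const_mul c).ofReal_comp).mul_const Complex.I
      simpa using this
    convert! ((h1.cexp).const_mul κ).const_add 1 using 1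
    ring
  set Φ : ℝ → ℂ := fun t => s⁻¹ * ((t : ℂ) + (2 * Complex.I)⁻¹ *
    (Complex.log (1 + κ * Complex.exp ((((-2) * t : ℝ) : ℂ) * Complex.I))
      - Complex.log (1 + κ * Complex.exp (((2 * t : ℝ) : ℂ) * Complex.I)))) with hΦ
  have hd : ∀ t, HasDerivAt Φ ((rsq s (Real.cos t, Real.sin t))⁻¹) t := by
    intro t
    have h0 : HasDerivAt (fun t : ℝ => (t : ℂ)) 1 t := Complex.ofRealCLM.hasDerivAt
    have h1 := (hE (-2) t).clog_real (hslit _)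
    have h2 := (hE 2 t).clog_real (hslit _)
    convert! (h0.add ((h1.sub h2).const_mul ((2 * Complex.I)⁻¹))).const_mul s⁻¹ using 1
    have n1 := Complex.slitPlane_ne_zero (hslit ((-2) * t))
    have n2 := Complex.slitPlane_ne_zero (hslit (2 * t))
    have e1 : Complex.exp ((((-2) * t : ℝ) : ℂ) * Complex.I)
        = Complex.cos (2 * t) - Complex.sin (2 * t) * Complex.I := by
      rw [Complex.exp_mul_I]
      push_cast
      rw [neg_mul, Complex.cos_neg, Complex.sin_neg]
      ring
    have e2 : Complex.exp (((2 * t : ℝ) : ℂ) * Complex.I)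
        = Complex.cos (2 * t) + Complex.sin (2 * t) * Complex.I := by
      rw [Complex.exp_mul_I]
      push_cast
      rfl
    have hcs := Complex.cos_sq_add_sin_sq (2 * (t : ℂ))
    have hc2 := Complex.cos_sq (t : ℂ)
    have hs2 := Complex.sin_sq (t : ℂ)
    have key := inv_eq_of_angle_parameter (e := Complex.exp ((((-2) * t : ℝ) : ℂ) * Complex.I))
      (f := Complex.exp (((2 * t : ℝ) : ℂ) * Complex.I)) (κ := κ) (s := s)
      (g := rsq s (Real.cos t, Real.sin t)) (div_mul_cancel₀ _ hs1)
      (by rw [e1, e2]; linear_combination hcs - Complex.sin (2 * t) ^ 2 * Complex.I_sq)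
      (by
        rw [e1, e2]
        simp only [rsq, Complex.ofReal_cos, Complex.ofReal_sin]
        rw [hs2, hc2]
        ring) n1 n2 hs0 hs1
    rw [key]
    push_cast
    ring
  have hcont : ContinuousOn (fun t : ℝ => (rsq s (Real.cos t, Real.sin t))⁻¹)
      (Set.uIcc (-Real.pi) Real.pi) := by
    refine ContinuousOn.inv₀ ?_ fun t _ => rsq_ne_zero hs (cos_sin_ne_zero t)
    exact ((continuous_rsq s).comp (by fun_prop)).continuousOn
  rw [intervalIntegral.integral_eq_sub_of_hasDerivAt (fun t _ => hd t) hcont.intervalIntegrable]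
  have p1 : Complex.exp ((((-2) * Real.pi : ℝ) : ℂ) * Complex.I) = 1 := by
    rw [Complex.exp_eq_one_iff]; exact ⟨-1, by push_cast; ring⟩
  have p2 : Complex.exp (((2 * Real.pi : ℝ) : ℂ) * Complex.I) = 1 := by
    rw [Complex.exp_eq_one_iff]; exact ⟨1, by push_cast; ring⟩
  have p3 : (-2 : ℝ) * -Real.pi = 2 * Real.pi := by ring
  have p4 : (2 : ℝ) * -Real.pi = (-2) * Real.pi := by ring
  simp only [hΦ, p3, p4, p1, p2]
  push_cast
  field_simp
  ring

/-- The flux of `(K₁ s, K₂ s)` through the origin, that is, `∂₁ K₁ + ∂₂ K₂ = (2 π / s) δ`. In polar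
coordinates `(K₁, K₂) · ∇φ` is the radial derivative of `φ` times a function of the angle. -/
theorem integral_K₁_mul_D₁_add_K₂_mul_D₂ {s : ℂ} (hs : 0 < s.re) {φ : ℝ × ℝ → ℝ} (h : IsTest φ) :
    (∫ x, K₁ s x * (D₁ φ x : ℂ)) + (∫ x, K₂ s x * (D₂ φ x : ℂ))
      = -(2 * Real.pi / s) * (φ 0 : ℂ) := by
  rw [← integral_add (h.isTest_D₁.integrable_mul (locallyIntegrable_K₁ hs))
    (h.isTest_D₂.integrable_mul (locallyIntegrable_K₂ hs)), ← integral_comp_polarCoord_symm]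
  set ν : ℝ → ℂ := fun t => (rsq s (Real.cos t, Real.sin t))⁻¹ with hν
  have hνc : Continuous ν :=
    ((continuous_rsq s).comp (by fun_prop)).inv₀ fun t => rsq_ne_zero hs (cos_sin_ne_zero t)
  set d : ℝ × ℝ → ℝ := fun y => Real.cos y.2 * D₁ φ (y.1 * Real.cos y.2, y.1 * Real.sin y.2)
    + Real.sin y.2 * D₂ φ (y.1 * Real.cos y.2, y.1 * Real.sin y.2) with hd
  have hdc : Continuous d := by
    have h1 := h.isTest_D₁.continuous
    have h2 := h.isTest_D₂.continuous
    fun_prop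
  have hH : Continuous fun y : ℝ × ℝ => (d y : ℂ) * ν y.2 := by fun_prop
  obtain ⟨R, hR⟩ : ∃ R : ℝ, ∀ x : ℝ × ℝ, x ∈ tsupport φ → ‖x‖ ≤ R :=
    h.2.isCompact.isBounded.exists_norm_le
  -- the supremum norm of a point at Euclidean distance `ρ` from the origin is at least `ρ / 2`
  have hout : ∀ ρ t : ℝ, 2 * R < ρ → (ρ * Real.cos t, ρ * Real.sin t) ∉ tsupport φ := by
    intro ρ t hρ hmem
    have h1 := hR _ hmem
    have h2 : |ρ * Real.cos t| ≤ R := (norm_fst_le _).trans h1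
    have h3 : |ρ * Real.sin t| ≤ R := (norm_snd_le _).trans h1
    have hR0 : 0 ≤ R := (norm_nonneg _).trans h1
    have h4 := sq_le_sq' (by linarith [neg_abs_le (ρ * Real.cos t)]) ((le_abs_self _).trans h2)
    have h5 := sq_le_sq' (by linarith [neg_abs_le (ρ * Real.sin t)]) ((le_abs_self _).trans h3)
    have h6 := Real.cos_sq_add_sin_sq t
    have h7 : ρ ^ 2 ≤ 2 * R ^ 2 := by
      calc ρ ^ 2 = ρ ^ 2 * (Real.cos t ^ 2 + Real.sin t ^ 2) := by rw [h6, mul_one]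
        _ = (ρ * Real.cos t) ^ 2 + (ρ * Real.sin t) ^ 2 := by ring
        _ ≤ 2 * R ^ 2 := by linarith
    nlinarith
  have hzero : ∀ ρ t : ℝ, 2 * R < ρ → d (ρ, t) = 0 := by
    intro ρ t hρ
    have h0 : fderiv ℝ φ (ρ * Real.cos t, ρ * Real.sin t) = 0 :=
      image_eq_zero_of_notMem_tsupport fun hm => hout ρ t hρ (tsupport_fderiv_subset ℝ hm)
    simp [hd, D₁, D₂, h0]
  have hint : IntegrableOn (fun y : ℝ × ℝ => (d y : ℂ) * ν y.2)
      (Set.Ioi (0 : ℝ) ×ˢ Set.Ioo (-Real.pi) Real.pi) := by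
    refine IntegrableOn.of_forall_sdiff_eq_zero
      (s := Set.Icc 0 (2 * R) ×ˢ Set.Icc (-Real.pi) Real.pi)
      (hH.continuousOn.integrableOn_compact (isCompact_Icc.prod isCompact_Icc))
      (measurableSet_Ioi.prod measurableSet_Ioo) ?_
    rintro ⟨ρ, t⟩ ⟨⟨h1, h2⟩, h3⟩
    have : 2 * R < ρ := by
      by_contra! hle
      exact h3 ⟨⟨le_of_lt h1, hle⟩, Set.Ioo_subset_Icc_self h2⟩
    simp [hzero ρ t this]
  have hradial : ∀ t, ∫ ρ in Set.Ioi (0 : ℝ), (d (ρ, t) : ℂ) * ν t = -(φ 0 : ℂ) * ν t := by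
    intro t
    rw [integral_mul_const]
    congr 1
    have hder : ∀ ρ ∈ Set.Ici (0 : ℝ), HasDerivAt
        (fun ρ : ℝ => (φ (ρ * Real.cos t, ρ * Real.sin t) : ℂ)) (d (ρ, t) : ℂ) ρ := by
      intro ρ _
      refine HasDerivAt.ofReal_comp ?_
      have hc : HasDerivAt (fun ρ : ℝ => (ρ * Real.cos t, ρ * Real.sin t))
          (Real.cos t, Real.sin t) ρ := by
        simpa using ((hasDerivAt_id ρ).mul_const (Real.cos t)).prodMk
          ((hasDerivAt_id ρ).mul_const (Real.sin t))
      exact h.hasDerivAt_line hc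
    have hi : IntegrableOn (fun ρ : ℝ => (d (ρ, t) : ℂ)) (Set.Ioi 0) := by
      refine IntegrableOn.of_forall_sdiff_eq_zero (s := Set.Icc 0 (2 * R))
        (Continuous.continuousOn (by fun_prop)).integrableOn_Icc measurableSet_Ioi ?_
      rintro ρ ⟨h1, h2⟩
      have : 2 * R < ρ := by
        by_contra! hle
        exact h2 ⟨le_of_lt h1, hle⟩
      simp [hzero ρ t this]
    have hlim : Tendsto (fun ρ : ℝ => (φ (ρ * Real.cos t, ρ * Real.sin t) : ℂ)) atTop (𝓝 0) := by
      refine tendsto_const_nhds.congr' ?_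
      filter_upwards [eventually_gt_atTop (2 * R)] with ρ hρ
      rw [image_eq_zero_of_notMem_tsupport (hout ρ t hρ), Complex.ofReal_zero]
    rw [integral_Ioi_of_hasDerivAt_of_tendsto' hder hi hlim]
    simp
    rfl
  have hpolar : ∀ y ∈ polarCoord.target,
      y.1 • (K₁ s (polarCoord.symm y) * (D₁ φ (polarCoord.symm y) : ℂ)
        + K₂ s (polarCoord.symm y) * (D₂ φ (polarCoord.symm y) : ℂ)) = (d y : ℂ) * ν y.2 := by
    rintro ⟨ρ, t⟩ ⟨hρ, _⟩
    have hρ0 : (ρ : ℂ) ≠ 0 := by exact_mod_cast (ne_of_gt hρ : ρ ≠ 0)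
    have e1 : polarCoord.symm (ρ, t) = (ρ * Real.cos t, ρ * Real.sin t) := rfl
    have e2 : rsq s (ρ * Real.cos t, ρ * Real.sin t)
        = (ρ : ℂ) ^ 2 * rsq s (Real.cos t, Real.sin t) := by
      simpa using rsq_smul s ρ (Real.cos t, Real.sin t)
    have e3 := rsq_ne_zero hs (cos_sin_ne_zero t)
    rw [e1]
    simp only [K₁, K₂, e2, hν, hd, Complex.real_smul]
    push_cast
    field_simp
  rw [setIntegral_congr_fun polarCoord.open_target.measurableSet hpolar]
  have htarget : polarCoord.target = Set.Ioi (0 : ℝ) ×ˢ Set.Ioo (-Real.pi) Real.pi := rfl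
  rw [htarget]
  rw [IntegrableOn, Measure.volume_eq_prod, ← Measure.prod_restrict] at hint
  rw [Measure.volume_eq_prod, ← Measure.prod_restrict, integral_prod_symm _ hint]
  simp only [hradial]
  rw [integral_const_mul, ← integral_Ioc_eq_integral_Ioo,
    ← intervalIntegral.integral_of_le (by linarith [Real.pi_pos]), integral_inv_rsq_cos_sin hs]
  ring

section

/-! ### The difference of the two angles -/

theorem one_add_mul_I_ne_zero {z : ℂ} (h : z.re ≠ 0 ∨ |z.im| < 1) : 1 + z * Complex.I ≠ 0 := by
  intro h0
  have hr := congrArg Complex.re h0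
  have hi := congrArg Complex.im h0
  simp at hr hi
  linarith [(abs_lt.1 (h.resolve_left (not_not_intro hi))).2]

theorem one_sub_mul_I_ne_zero {z : ℂ} (h : z.re ≠ 0 ∨ |z.im| < 1) : 1 - z * Complex.I ≠ 0 := by
  intro h0
  have hr := congrArg Complex.re h0
  have hi := congrArg Complex.im h0
  simp at hr hi
  linarith [(abs_lt.1 (h.resolve_left (not_not_intro hi))).1]

/-- The hypothesis on `z` says that `z` avoids the branch cuts of the arctangent. -/
theorem div_mem_slitPlane_of_arctan {z : ℂ} (h : z.re ≠ 0 ∨ |z.im| < 1) :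
    (1 + z * Complex.I) / (1 - z * Complex.I) ∈ Complex.slitPlane := by
  have hpos := Complex.normSq_pos.2 (one_sub_mul_I_ne_zero h)
  have e : (1 + z * Complex.I) / (1 - z * Complex.I)
      = (((Complex.normSq (1 - z * Complex.I))⁻¹ : ℝ) : ℂ)
        * ((1 + z * Complex.I) * (starRingEnd ℂ) (1 - z * Complex.I)) := by
    rw [div_eq_mul_inv, Complex.inv_def]
    ring
  rw [e, Complex.mem_slitPlane_iff, Complex.re_ofReal_mul, Complex.im_ofReal_mul]
  have hre : ((1 + z * Complex.I) * (starRingEnd ℂ) (1 - z * Complex.I)).re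
      = 1 - z.re ^ 2 - z.im ^ 2 := by
    simp
    ring
  have him' : ((1 + z * Complex.I) * (starRingEnd ℂ) (1 - z * Complex.I)).im = 2 * z.re := by
    simp
    ring
  rw [hre, him']
  by_cases h0 : z.re = 0
  · left
    have := abs_lt.1 (h.resolve_left (not_not_intro h0))
    refine mul_pos (inv_pos.2 hpos) ?_
    rw [h0]
    nlinarith
  · right
    positivity

theorem hasDerivAt_arctan {z : ℂ} (h : z.re ≠ 0 ∨ |z.im| < 1) :
    HasDerivAt Complex.arctan (1 + z ^ 2)⁻¹ z := by
  have n1 := one_add_mul_I_ne_zero h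
  have n2 := one_sub_mul_I_ne_zero h
  have hslit := div_mem_slitPlane_of_arctan h
  have hd1 : HasDerivAt (fun z : ℂ => 1 + z * Complex.I) Complex.I z := by
    simpa using ((hasDerivAt_id z).mul_const Complex.I).const_add 1
  have hd2 : HasDerivAt (fun z : ℂ => 1 - z * Complex.I) (-Complex.I) z := by
    simpa using ((hasDerivAt_id z).mul_const Complex.I).const_sub 1
  convert! ((hd1.div hd2 n2).clog hslit).const_mul (-Complex.I / 2) using 1
  have n3 : 1 + z ^ 2 = (1 + z * Complex.I) * (1 - z * Complex.I) := by
    linear_combination z ^ 2 * Complex.I_sq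
  rw [n3, Pi.div_apply]
  field_simp
  linear_combination 2 * Complex.I_sq

@[simp]
theorem arctan_zero : Complex.arctan 0 = 0 := by simp [Complex.arctan]

/-- The angle `θ₂ - θ₁` for a pair of characteristic roots with product `1`, as a single arctangent
by the addition theorem. Unlike each `θ`, it is smooth across the line `x₁ = 0`. -/
def angle (s s' : ℂ) (x : ℝ × ℝ) : ℂ :=
  Complex.arctan ((s' - s) * ((x.1 * x.2 / (x.1 ^ 2 + x.2 ^ 2) : ℝ) : ℂ))

variable {s s' : ℂ}

theorem re_pos_of_mul_eq_one (hs : 0 < s.re) (h : s * s' = 1) : 0 < s'.re := by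
  rw [eq_inv_of_mul_eq_one_right h, Complex.inv_re]
  exact div_pos hs (Complex.normSq_pos.2 fun h0 => by simp [h0] at hs)

/-- Where the real part of `s' - s` vanishes, `s` lies on the unit circle, and the argument of the
arctangent in `angle` stays off its branch cuts because `|x₁ x₂| ≤ (x₁² + x₂²) / 2`. -/
theorem angle_arg_mem (hs : 0 < s.re) (h : s * s' = 1) (x : ℝ × ℝ) :
    ((s' - s) * ((x.1 * x.2 / (x.1 ^ 2 + x.2 ^ 2) : ℝ) : ℂ)).re ≠ 0 ∨
      |((s' - s) * ((x.1 * x.2 / (x.1 ^ 2 + x.2 ^ 2) : ℝ) : ℂ)).im| < 1 := by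
  have hτ : |x.1 * x.2 / (x.1 ^ 2 + x.2 ^ 2)| ≤ 1 / 2 := by
    rw [abs_div, abs_of_nonneg (by positivity : 0 ≤ x.1 ^ 2 + x.2 ^ 2)]
    refine div_le_of_le_mul₀ (by positivity) (by norm_num) ?_
    rw [abs_mul]
    nlinarith [sq_nonneg (|x.1| - |x.2|), sq_abs x.1, sq_abs x.2]
  set τ := x.1 * x.2 / (x.1 ^ 2 + x.2 ^ 2)
  rw [Complex.re_mul_ofReal, Complex.im_mul_ofReal, Complex.sub_re, Complex.sub_im]
  have e1 : s.re * s'.re - s.im * s'.im = 1 := by simpa using congrArg Complex.re h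
  have e2 : s.re * s'.im + s.im * s'.re = 0 := by simpa using congrArg Complex.im h
  by_contra! hcon
  obtain ⟨h1, h2⟩ := hcon
  rcases mul_eq_zero.1 h1 with h3 | h3
  · have h4 : s'.re = s.re := by linarith
    rw [h4] at e1 e2
    have h5 : s'.im = -s.im := by
      have : s.re * (s'.im + s.im) = 0 := by linarith
      linarith [(mul_eq_zero.1 this).resolve_left hs.ne']
    rw [h5] at e1 h2
    have h6 : |s.im| < 1 := by
      rw [← sq_lt_one_iff_abs_lt_one]
      nlinarith
    have h7 : |(-s.im - s.im) * τ| = 2 * |s.im| * |τ| := by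
      rw [show (-s.im - s.im) * τ = -(2 * s.im * τ) by ring, abs_neg, abs_mul, abs_mul, abs_two]
    rw [h7] at h2
    nlinarith [abs_nonneg s.im, abs_nonneg τ]
  · rw [h3] at h2
    norm_num at h2

theorem sq_add_sq_pos {x : ℝ × ℝ} (hx : x ≠ 0) : 0 < x.1 ^ 2 + x.2 ^ 2 := by
  by_contra! h
  have h1 : x.1 ^ 2 = 0 := by nlinarith [sq_nonneg x.1, sq_nonneg x.2]
  have h2 : x.2 ^ 2 = 0 := by nlinarith [sq_nonneg x.1, sq_nonneg x.2]
  exact hx (Prod.ext (pow_eq_zero_iff two_ne_zero |>.1 h1) (pow_eq_zero_iff two_ne_zero |>.1 h2))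

theorem rsq_mul_rsq (h : s * s' = 1) (x : ℝ × ℝ) : rsq s x * rsq s' x
    = ((x.1 ^ 2 + x.2 ^ 2 : ℝ) : ℂ) ^ 2 + ((s' - s) * (x.1 * x.2)) ^ 2 := by
  simp only [rsq]
  push_cast
  linear_combination (2 * (x.1 : ℂ) ^ 2 * x.2 ^ 2 + (1 + s * s') * x.2 ^ 4) * h

theorem hasDerivAt_angle_fst (hs : 0 < s.re) (h : s * s' = 1) {x : ℝ × ℝ} (hx : x ≠ 0) :
    HasDerivAt (fun t : ℝ => angle s s' (t, x.2)) (s * K₂ s x - s' * K₂ s' x) x.1 := by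
  have hn := sq_add_sq_pos hx
  have hin : HasDerivAt (fun t : ℝ => t * x.2 / (t ^ 2 + x.2 ^ 2))
      (x.2 * (x.2 ^ 2 - x.1 ^ 2) / (x.1 ^ 2 + x.2 ^ 2) ^ 2) x.1 := by
    convert! ((hasDerivAt_id x.1).mul_const x.2).div
      (((hasDerivAt_id x.1).pow 2).add_const (x.2 ^ 2)) hn.ne' using 1
    simp
    ring
  have h1 := (hasDerivAt_arctan (angle_arg_mem hs h x)).comp x.1
    (hin.ofReal_comp.const_mul (s' - s))
  convert! h1 using 1
  have n1 := rsq_ne_zero hs hx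
  have n2 := rsq_ne_zero (re_pos_of_mul_eq_one hs h) hx
  have n3 : ((x.1 ^ 2 + x.2 ^ 2 : ℝ) : ℂ) ≠ 0 := by exact_mod_cast hn.ne'
  have e : 1 + ((s' - s) * ((x.1 * x.2 / (x.1 ^ 2 + x.2 ^ 2) : ℝ) : ℂ)) ^ 2
      = rsq s x * rsq s' x / ((x.1 ^ 2 + x.2 ^ 2 : ℝ) : ℂ) ^ 2 := by
    rw [rsq_mul_rsq h, Complex.ofReal_div]
    field_simp
    push_cast
    ring
  rw [e, Complex.ofReal_div, Complex.ofReal_pow]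
  simp only [K₂]
  field_simp
  simp only [rsq]
  push_cast
  linear_combination ((s' - s) * (x.2 : ℂ) ^ 3) * h

theorem hasDerivAt_angle_snd (hs : 0 < s.re) (h : s * s' = 1) {x : ℝ × ℝ} (hx : x ≠ 0) :
    HasDerivAt (fun t : ℝ => angle s s' (x.1, t)) (s' * K₁ s' x - s * K₁ s x) x.2 := by
  have hn := sq_add_sq_pos hx
  have hin : HasDerivAt (fun t : ℝ => x.1 * t / (x.1 ^ 2 + t ^ 2))
      (x.1 * (x.1 ^ 2 - x.2 ^ 2) / (x.1 ^ 2 + x.2 ^ 2) ^ 2) x.2 := by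
    convert! ((hasDerivAt_id x.2).const_mul x.1).div
      (((hasDerivAt_id x.2).pow 2).const_add (x.1 ^ 2)) hn.ne' using 1
    simp
    ring
  have h1 := (hasDerivAt_arctan (angle_arg_mem hs h x)).comp x.2
    (hin.ofReal_comp.const_mul (s' - s))
  convert! h1 using 1
  have n1 := rsq_ne_zero hs hx
  have n2 := rsq_ne_zero (re_pos_of_mul_eq_one hs h) hx
  have n3 : ((x.1 ^ 2 + x.2 ^ 2 : ℝ) : ℂ) ≠ 0 := by exact_mod_cast hn.ne'
  have e : 1 + ((s' - s) * ((x.1 * x.2 / (x.1 ^ 2 + x.2 ^ 2) : ℝ) : ℂ)) ^ 2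
      = rsq s x * rsq s' x / ((x.1 ^ 2 + x.2 ^ 2 : ℝ) : ℂ) ^ 2 := by
    rw [rsq_mul_rsq h, Complex.ofReal_div]
    field_simp
    push_cast
    ring
  rw [e, Complex.ofReal_div, Complex.ofReal_pow]
  simp only [K₁]
  field_simp
  simp only [rsq]
  push_cast
  linear_combination ((s - s') * (x.2 : ℂ) ^ 2 * x.1) * h

theorem hasDerivAt_θ_snd (hs : 0 < s.re) {a : ℝ} (ha : a ≠ 0) (b : ℝ) :
    HasDerivAt (fun t : ℝ => θ s (a, t)) (s * K₁ s (a, b)) b := by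
  have hac : (a : ℂ) ≠ 0 := by exact_mod_cast ha
  have hmem : (s * b / a).re ≠ 0 ∨ |(s * b / a).im| < 1 := by
    by_cases hb : b = 0
    · right
      simp [hb]
    · left
      rw [Complex.div_ofReal_re, Complex.re_mul_ofReal]
      have := hs.ne'
      positivity
  have hin : HasDerivAt (fun t : ℝ => s * (t : ℂ) / a) (s / a) b := by
    simpa using ((Complex.ofRealCLM.hasDerivAt (x := b)).const_mul s).div_const (a : ℂ)
  have h1 := (hasDerivAt_arctan hmem).comp b hin
  convert! h1 using 1
  have n1 : rsq s (a, b) ≠ 0 := rsq_ne_zero hs fun h0 => ha (congrArg Prod.fst h0)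
  have e : 1 + (s * b / a) ^ 2 = rsq s (a, b) / (a : ℂ) ^ 2 := by
    simp only [rsq]
    field_simp
  rw [e]
  simp only [K₁]
  field_simp

/-- For fixed `x₁ ≠ 0` both sides vanish at `x₂ = 0` and have the same derivative in `x₂`; for
`x₁ = 0` both sides are `0`, on the left by the convention `x / 0 = 0`. -/
theorem θ_sub_θ (hs : 0 < s.re) (h : s * s' = 1) (x : ℝ × ℝ) : θ s' x - θ s x = angle s s' x := by
  obtain ⟨a, b⟩ := x
  by_cases ha : a = 0
  · simp [θ, angle, ha]
  have hd : ∀ t : ℝ,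
      HasDerivAt (fun t : ℝ => θ s' (a, t) - θ s (a, t) - angle s s' (a, t)) 0 t := by
    intro t
    have h1 := ((hasDerivAt_θ_snd (re_pos_of_mul_eq_one hs h) ha t).sub
      (hasDerivAt_θ_snd hs ha t)).sub
      (hasDerivAt_angle_snd hs h (x := (a, t)) fun h0 => ha (congrArg Prod.fst h0))
    rw [sub_self] at h1
    exact h1
  have hc := is_const_of_deriv_eq_zero (fun t => (hd t).differentiableAt)
    (fun t => (hd t).deriv) b 0
  have h0 : θ s' (a, 0) - θ s (a, 0) - angle s s' (a, 0) = 0 := by simp [θ, angle]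
  exact sub_eq_zero.1 (hc.trans h0)

theorem locallyIntegrable_angle (hs : 0 < s.re) (h : s * s' = 1) :
    LocallyIntegrable (angle s s') := by
  refine locallyIntegrable_of_ray_bound (fun x hx => ContinuousAt.continuousWithinAt ?_)
    fun t ht y hy => ?_
  · have hin : ContinuousAt (fun x : ℝ × ℝ =>
        (s' - s) * ((x.1 * x.2 / (x.1 ^ 2 + x.2 ^ 2) : ℝ) : ℂ)) x := by
      refine continuousAt_const.mul (Complex.continuous_ofReal.continuousAt.comp ?_)
      exact ContinuousAt.div (by fun_prop) (by fun_prop) (sq_add_sq_pos hx).ne'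
    exact (hasDerivAt_arctan (angle_arg_mem hs h x)).continuousAt.comp_of_eq hin rfl
  · have e : angle s s' (t • y) = angle s s' y := by
      simp only [angle, Prod.smul_fst, Prod.smul_snd, smul_eq_mul]
      have := (sq_add_sq_pos hy).ne'
      congr 3
      field_simp
    rw [e]
    refine (le_mul_of_one_le_right (norm_nonneg _) (one_le_add_inv ht)).trans ?_
    gcongr
    linarith

theorem integral_angle_mul_D₁ (hs : 0 < s.re) (h : s * s' = 1) {φ : ℝ × ℝ → ℝ} (hφ : IsTest φ) :
    ∫ x, angle s s' x * (D₁ φ x : ℂ)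
      = -(s * (∫ x, K₂ s x * (φ x : ℂ)) - s' * ∫ x, K₂ s' x * (φ x : ℂ)) := by
  have l1 := (locallyIntegrable_K₂ hs).smul s
  have l2 := (locallyIntegrable_K₂ (re_pos_of_mul_eq_one hs h)).smul s'
  rw [integral_mul_D₁ (G := fun x => s * K₂ s x - s' * K₂ s' x) (locallyIntegrable_angle hs h)
    (l1.sub l2) (fun _ hx => hasDerivAt_angle_fst hs h hx) hφ, ← integral_const_mul,
    ← integral_const_mul, ← integral_sub]
  · simp only [sub_mul, mul_assoc]
  · simpa only [mul_assoc, Pi.smul_apply, smul_eq_mul] using hφ.integrable_mul l1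
  · simpa only [mul_assoc, Pi.smul_apply, smul_eq_mul] using hφ.integrable_mul l2

theorem integral_angle_mul_D₂ (hs : 0 < s.re) (h : s * s' = 1) {φ : ℝ × ℝ → ℝ} (hφ : IsTest φ) :
    ∫ x, angle s s' x * (D₂ φ x : ℂ)
      = -(s' * (∫ x, K₁ s' x * (φ x : ℂ)) - s * ∫ x, K₁ s x * (φ x : ℂ)) := by
  have l1 := (locallyIntegrable_K₁ hs).smul s
  have l2 := (locallyIntegrable_K₁ (re_pos_of_mul_eq_one hs h)).smul s'
  rw [integral_mul_D₂ (G := fun x => s' * K₁ s' x - s * K₁ s x) (locallyIntegrable_angle hs h)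
    (l2.sub l1) (fun _ hx => hasDerivAt_angle_snd hs h hx) hφ, ← integral_const_mul,
    ← integral_const_mul, ← integral_sub]
  · simp only [sub_mul, mul_assoc]
  · simpa only [mul_assoc, Pi.smul_apply, smul_eq_mul] using hφ.integrable_mul l2
  · simpa only [mul_assoc, Pi.smul_apply, smul_eq_mul] using hφ.integrable_mul l1

end

variable {lam mu mus : ℝ}

/-! ### The characteristic roots -/

theorem cpow_half_sq (z : ℂ) : (z ^ (1 / 2 : ℂ)) ^ 2 = z := by
  simp

theorem cpow_half_re_pos {z : ℂ} (hz : z ∈ Complex.slitPlane) : 0 < (z ^ (1 / 2 : ℂ)).re := by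
  rw [Complex.cpow_def_of_ne_zero (Complex.slitPlane_ne_zero hz), Complex.exp_re,
    show (1 / 2 : ℂ) = ((1 / 2 : ℝ) : ℂ) by push_cast; rfl, Complex.im_mul_ofReal, Complex.log_im]
  refine mul_pos (Real.exp_pos _) (Real.cos_pos_of_mem_Ioo ⟨?_, ?_⟩)
  · linarith [Complex.neg_pi_lt_arg z]
  · linarith [(Complex.arg_le_pi z).lt_of_ne (Complex.slitPlane_arg_ne_pi hz)]

theorem conj_cpow_half {z : ℂ} (hz : z ∈ Complex.slitPlane) :
    (starRingEnd ℂ) (z ^ (1 / 2 : ℂ)) = ((starRingEnd ℂ) z) ^ (1 / 2 : ℂ) := by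
  rw [Complex.conj_cpow _ _ (Complex.slitPlane_arg_ne_pi hz),
    show (1 / 2 : ℂ) = ((1 / 2 : ℝ) : ℂ) by push_cast; rfl, Complex.conj_ofReal]

theorem sqrtq_sq (lam mu mus : ℝ) : sqrtq lam mu mus ^ 2 = (q lam mu mus : ℂ) := cpow_half_sq _

/-- Together with `s₁² s₂² = (p² - q) / (2 μ* (λ + 2 μ))²` this gives `s₁² s₂² = 1`. -/
theorem p_sq_sub_q (lam mu mus : ℝ) :
    p lam mu mus ^ 2 - q lam mu mus = (2 * mus * (lam + 2 * mu)) ^ 2 := by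
  simp only [p, q]; ring

theorem q_ne_zero (hmu : 0 < mu) (hlam : 0 < lam + mu) (hmus : 0 < mus) (hne : mus ≠ mu) :
    q lam mu mus ≠ 0 := by
  have h1 : mu - mus ≠ 0 := sub_ne_zero.2 hne.symm
  have h2 : 0 < lam + mu + mus := by linarith
  simp only [q]
  positivity

theorem sqrtq_ne_zero (hmu : 0 < mu) (hlam : 0 < lam + mu) (hmus : 0 < mus) (hne : mus ≠ mu) :
    sqrtq lam mu mus ≠ 0 := fun h => by
  have := sqrtq_sq lam mu mus
  rw [h] at this
  exact q_ne_zero hmu hlam hmus hne (by exact_mod_cast this.symm.trans (zero_pow two_ne_zero))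

/-- For `mus < mu` the root `√q` is real and smaller than `-p` in absolute value; for `mu < mus` it
is purely imaginary. -/
theorem sqrtq_cases (hmu : 0 < mu) (hlam : 0 < lam + mu) (hmus : 0 < mus) (hne : mus ≠ mu) :
    ((sqrtq lam mu mus).im = 0 ∧ |(sqrtq lam mu mus).re| < -p lam mu mus) ∨
      ((sqrtq lam mu mus).re = 0 ∧ (sqrtq lam mu mus).im ≠ 0) := by
  have hsq := sqrtq_sq lam mu mus
  set w := sqrtq lam mu mus
  have hre : w.re ^ 2 - w.im ^ 2 = q lam mu mus := by
    have := congrArg Complex.re hsq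
    simp [pow_two] at this
    linarith
  have him : w.re * w.im = 0 := by
    have := congrArg Complex.im hsq
    simp [pow_two] at this
    linarith
  have hpos : 0 < 16 * mu * (lam + mu) * (lam + mu + mus) := by
    have : 0 < lam + mu + mus := by linarith
    positivity
  have hq : q lam mu mus = (mu - mus) * (16 * mu * (lam + mu) * (lam + mu + mus)) := by
    simp only [q]; ring
  rcases lt_or_gt_of_ne hne with h | h
  · have hq0 : 0 < q lam mu mus := by
      rw [hq]
      exact mul_pos (by linarith) hpos
    have hre0 : w.re ≠ 0 := fun h0 => by
      rw [h0] at hre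
      nlinarith [sq_nonneg w.im]
    have him0 : w.im = 0 := (mul_eq_zero.1 him).resolve_left hre0
    have hp : 0 < -p lam mu mus := by
      simp only [p]
      nlinarith [mul_pos hmu hlam, mul_pos hmus hlam, mul_pos hmu hmus, mul_pos hlam (sub_pos.2 h)]
    refine Or.inl ⟨him0, abs_lt_of_sq_lt_sq ?_ hp.le⟩
    rw [him0] at hre
    have := p_sq_sub_q lam mu mus
    have h3 : 0 < (2 * mus * (lam + 2 * mu)) ^ 2 := by
      have : 0 < lam + 2 * mu := by linarith
      positivity
    nlinarith
  · have hq0 : q lam mu mus < 0 := by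
      rw [hq]
      exact mul_neg_of_neg_of_pos (by linarith) hpos
    have him0 : w.im ≠ 0 := fun h0 => by
      rw [h0] at hre
      nlinarith [sq_nonneg w.re]
    exact Or.inr ⟨(mul_eq_zero.1 him).resolve_right him0, him0⟩

theorem neg_p_sub_sqrtq_mem (hmu : 0 < mu) (hlam : 0 < lam + mu) (hmus : 0 < mus)
    (hne : mus ≠ mu) : -(p lam mu mus : ℂ) - sqrtq lam mu mus ∈ Complex.slitPlane := by
  rw [Complex.mem_slitPlane_iff]
  rcases sqrtq_cases hmu hlam hmus hne with ⟨_, h⟩ | ⟨_, h⟩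
  · left
    simp
    linarith [le_abs_self (sqrtq lam mu mus).re]
  · right
    simpa using h

theorem neg_p_add_sqrtq_mem (hmu : 0 < mu) (hlam : 0 < lam + mu) (hmus : 0 < mus)
    (hne : mus ≠ mu) : -(p lam mu mus : ℂ) + sqrtq lam mu mus ∈ Complex.slitPlane := by
  rw [Complex.mem_slitPlane_iff]
  rcases sqrtq_cases hmu hlam hmus hne with ⟨_, h⟩ | ⟨_, h⟩
  · left
    simp
    linarith [neg_abs_le (sqrtq lam mu mus).re]
  · right
    simpa using h

theorem moduli_pos (hmu : 0 < mu) (hlam : 0 < lam + mu) (hmus : 0 < mus) :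
    0 < 2 * mus * (lam + 2 * mu) := by
  have : 0 < lam + 2 * mu := by linarith
  positivity

theorem s₁_re_pos (hmu : 0 < mu) (hlam : 0 < lam + mu) (hmus : 0 < mus) (hne : mus ≠ mu) :
    0 < (s₁ lam mu mus).re := by
  rw [s₁, Complex.div_ofReal_re]
  exact div_pos (cpow_half_re_pos (neg_p_sub_sqrtq_mem hmu hlam hmus hne))
    (Real.sqrt_pos.2 (moduli_pos hmu hlam hmus))

theorem s₂_re_pos (hmu : 0 < mu) (hlam : 0 < lam + mu) (hmus : 0 < mus) (hne : mus ≠ mu) :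
    0 < (s₂ lam mu mus).re := by
  rw [s₂, Complex.div_ofReal_re]
  exact div_pos (cpow_half_re_pos (neg_p_add_sqrtq_mem hmu hlam hmus hne))
    (Real.sqrt_pos.2 (moduli_pos hmu hlam hmus))

theorem s₁_sq (hmu : 0 < mu) (hlam : 0 < lam + mu) (hmus : 0 < mus) :
    2 * mus * (lam + 2 * mu) * s₁ lam mu mus ^ 2 = -(p lam mu mus : ℂ) - sqrtq lam mu mus := by
  have h := moduli_pos hmu hlam hmus
  have h1 : (2 * mus * (lam + 2 * mu) : ℂ) = ((√(2 * mus * (lam + 2 * mu)) : ℝ) : ℂ) ^ 2 := by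
    rw [← Complex.ofReal_pow, Real.sq_sqrt h.le]
    push_cast
    rfl
  have h2 : ((√(2 * mus * (lam + 2 * mu)) : ℝ) : ℂ) ≠ 0 := by
    exact_mod_cast (Real.sqrt_pos.2 h).ne'
  rw [s₁, div_pow, cpow_half_sq, h1]
  field_simp

theorem s₂_sq (hmu : 0 < mu) (hlam : 0 < lam + mu) (hmus : 0 < mus) :
    2 * mus * (lam + 2 * mu) * s₂ lam mu mus ^ 2 = -(p lam mu mus : ℂ) + sqrtq lam mu mus := by
  have h := moduli_pos hmu hlam hmus
  have h1 : (2 * mus * (lam + 2 * mu) : ℂ) = ((√(2 * mus * (lam + 2 * mu)) : ℝ) : ℂ) ^ 2 := by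
    rw [← Complex.ofReal_pow, Real.sq_sqrt h.le]
    push_cast
    rfl
  have h2 : ((√(2 * mus * (lam + 2 * mu)) : ℝ) : ℂ) ≠ 0 := by
    exact_mod_cast (Real.sqrt_pos.2 h).ne'
  rw [s₂, div_pow, cpow_half_sq, h1]
  field_simp

theorem s₁_mul_s₂ (hmu : 0 < mu) (hlam : 0 < lam + mu) (hmus : 0 < mus) (hne : mus ≠ mu) :
    s₁ lam mu mus * s₂ lam mu mus = 1 := by
  have e1 := s₁_sq hmu hlam hmus
  have e2 := s₂_sq hmu hlam hmus
  have r1 := s₁_re_pos hmu hlam hmus hne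
  have r2 := s₂_re_pos hmu hlam hmus hne
  have h0 : (2 * mus * (lam + 2 * mu) : ℂ) ≠ 0 := by
    exact_mod_cast (moduli_pos hmu hlam hmus).ne'
  have hpq : (p lam mu mus : ℂ) ^ 2 - q lam mu mus = (2 * mus * (lam + 2 * mu)) ^ 2 := by
    exact_mod_cast p_sq_sub_q lam mu mus
  have hw := sqrtq_sq lam mu mus
  set a := s₁ lam mu mus
  set b := s₂ lam mu mus
  have h1 : (a * b) ^ 2 = 1 := by
    refine mul_left_cancel₀ (pow_ne_zero 2 h0) ?_
    linear_combination (2 * mus * (lam + 2 * mu) * b ^ 2) * e1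
      + (-(p lam mu mus : ℂ) - sqrtq lam mu mus) * e2 + hpq - hw
  rcases mul_self_eq_one_iff.1 ((pow_two _).symm.trans h1) with h | h
  · exact h
  · -- a product `-1` would place the two roots in opposite half-planes
    have h3 : 0 < (-b).re := re_pos_of_mul_eq_one r1 (by linear_combination -h)
    rw [Complex.neg_re] at h3
    linarith

/-- Conjugation either fixes `√q`, `s₁`, `s₂`, or changes the sign of `√q` and exchanges the roots.
Both alternatives fix every expression `(f s₁ - f s₂) / √q` with `f` commuting with conjugation. -/
theorem conj_roots (hmu : 0 < mu) (hlam : 0 < lam + mu) (hmus : 0 < mus) (hne : mus ≠ mu) :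
    ((starRingEnd ℂ) (sqrtq lam mu mus) = sqrtq lam mu mus ∧
      (starRingEnd ℂ) (s₁ lam mu mus) = s₁ lam mu mus ∧
      (starRingEnd ℂ) (s₂ lam mu mus) = s₂ lam mu mus) ∨
    ((starRingEnd ℂ) (sqrtq lam mu mus) = -sqrtq lam mu mus ∧
      (starRingEnd ℂ) (s₁ lam mu mus) = s₂ lam mu mus ∧
      (starRingEnd ℂ) (s₂ lam mu mus) = s₁ lam mu mus) := by
  have c1 := conj_cpow_half (neg_p_sub_sqrtq_mem hmu hlam hmus hne)
  have c2 := conj_cpow_half (neg_p_add_sqrtq_mem hmu hlam hmus hne)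
  simp only [map_sub, map_add, map_neg, Complex.conj_ofReal] at c1 c2
  rcases sqrtq_cases hmu hlam hmus hne with ⟨h, _⟩ | ⟨h, _⟩
  · have hw : (starRingEnd ℂ) (sqrtq lam mu mus) = sqrtq lam mu mus := Complex.conj_eq_iff_im.2 h
    rw [hw] at c1 c2
    refine Or.inl ⟨hw, ?_, ?_⟩
    · rw [s₁, map_div₀, c1, Complex.conj_ofReal]
    · rw [s₂, map_div₀, c2, Complex.conj_ofReal]
  · have hw : (starRingEnd ℂ) (sqrtq lam mu mus) = -sqrtq lam mu mus := by
      apply Complex.ext <;> simp [h]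
    rw [hw] at c1 c2
    refine Or.inr ⟨hw, ?_, ?_⟩
    · rw [s₁, s₂, map_div₀, c1, Complex.conj_ofReal, sub_neg_eq_add]
    · rw [s₁, s₂, map_div₀, c2, Complex.conj_ofReal, ← sub_eq_add_neg]

theorem s₁_sq_sub_s₂_sq (hmu : 0 < mu) (hlam : 0 < lam + mu) (hmus : 0 < mus) :
    mus * (lam + 2 * mu) * (s₁ lam mu mus ^ 2 - s₂ lam mu mus ^ 2) = -sqrtq lam mu mus := by
  linear_combination (s₁_sq hmu hlam hmus) / 2 - (s₂_sq hmu hlam hmus) / 2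

/-- Vieta's formula for the biquadratic characteristic equation. -/
theorem s₁_sq_add_s₂_sq (hmu : 0 < mu) (hlam : 0 < lam + mu) (hmus : 0 < mus) :
    mus * (lam + 2 * mu) * (s₁ lam mu mus ^ 2 + s₂ lam mu mus ^ 2)
      = (lam + 2 * mu) ^ 2 + mus ^ 2 - (lam + mus : ℂ) ^ 2 := by
  have hp : (p lam mu mus : ℂ) = 2 * lam * mus - 4 * mu * (lam + mu) := by
    simp only [p]; push_cast; ring
  linear_combination (s₁_sq hmu hlam hmus) / 2 + (s₂_sq hmu hlam hmus) / 2 - hp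

theorem Y1_eq {s s' : ℂ} (h : s * s' = 1) :
    Y1 lam mu mus s = (lam + 2 * mu) * s - mus * s' := by
  have h0 : s ≠ 0 := left_ne_zero_of_mul_eq_one h
  rw [Y1, div_eq_iff h0]
  linear_combination (mus : ℂ) * h

theorem Y2_eq {s s' : ℂ} (h : s * s' = 1) :
    Y2 lam mu mus s = mus * s - (lam + 2 * mu) * s' := by
  have h0 : s ≠ 0 := left_ne_zero_of_mul_eq_one h
  rw [Y2, div_eq_iff h0]
  linear_combination ((lam : ℂ) + 2 * mu) * h

/-! ### Complex form of equilibrium -/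

/-- Equilibrium of a field whose components are given as complex-valued functions. -/
theorem isEquilibrium_of_complex {u : ℝ × ℝ → ℝ × ℝ} {U V : ℝ × ℝ → ℂ}
    (hU : ∀ x, U x = ((u x).1 : ℂ)) (hV : ∀ x, V x = ((u x).2 : ℂ))
    (lU : LocallyIntegrable U) (lV : LocallyIntegrable V) {f₁ f₂ : (ℝ × ℝ → ℝ) → ℝ}
    (h₁ : ∀ φ, IsTest φ → (lam + 2 * mu) * (∫ x, U x * (D₁ (D₁ φ) x : ℂ))
      + mus * (∫ x, U x * (D₂ (D₂ φ) x : ℂ))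
      + (lam + mus) * (∫ x, V x * (D₁ (D₂ φ) x : ℂ)) + f₁ φ = 0)
    (h₂ : ∀ φ, IsTest φ → (lam + 2 * mu) * (∫ x, V x * (D₂ (D₂ φ) x : ℂ))
      + mus * (∫ x, V x * (D₁ (D₁ φ) x : ℂ))
      + (lam + mus) * (∫ x, U x * (D₁ (D₂ φ) x : ℂ)) + f₂ φ = 0) :
    IsEquilibrium lam mu mus u f₁ f₂ := by
  have hre : ∀ {F : ℝ × ℝ → ℂ} {f : ℝ × ℝ → ℝ}, (∀ x, F x = (f x : ℂ)) → LocallyIntegrable F →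
      LocallyIntegrable f := by
    intro F f hF lF x
    obtain ⟨S, hS, hi⟩ := lF x
    refine ⟨S, hS, ?_⟩
    have := hi.re
    simp only [hF, RCLike.re_eq_complex_re, Complex.ofReal_re] at this
    exact this
  have hint : ∀ {a b c : ℝ} {F G : ℝ × ℝ → ℂ} {f g : ℝ × ℝ → ℝ} {ψ₁ ψ₂ ψ₃ : ℝ × ℝ → ℝ},
      (∀ x, F x = (f x : ℂ)) → (∀ x, G x = (g x : ℂ)) → LocallyIntegrable F → LocallyIntegrable G →
      IsTest ψ₁ → IsTest ψ₂ → IsTest ψ₃ →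
      ((∫ x, (f x * (a * ψ₁ x + b * ψ₂ x) + g x * (c * ψ₃ x)) : ℝ) : ℂ)
        = a * (∫ x, F x * (ψ₁ x : ℂ)) + b * (∫ x, F x * (ψ₂ x : ℂ))
          + c * (∫ x, G x * (ψ₃ x : ℂ)) := by
    intro a b c F G f g ψ₁ ψ₂ ψ₃ hF hG lF lG t₁ t₂ t₃
    have i₁ := (t₁.integrable_mul lF).const_mul (a : ℂ)
    have i₂ := (t₂.integrable_mul lF).const_mul (b : ℂ)
    have i₃ := (t₃.integrable_mul lG).const_mul (c : ℂ)
    have i₁₂ : Integrable fun x => (a : ℂ) * (F x * ψ₁ x) + b * (F x * ψ₂ x) := i₁.add i₂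
    rw [← integral_complex_ofReal, ← integral_const_mul, ← integral_const_mul, ← integral_const_mul,
      ← integral_add i₁ i₂, ← integral_add i₁₂ i₃]
    congr 1
    funext x
    rw [hF, hG]
    push_cast
    ring
  refine ⟨hre hU lU, hre hV lV, fun φ hφ hc => ?_⟩
  have t : IsTest φ := ⟨hφ, hc⟩
  constructor
  · rw [← Complex.ofReal_inj, Complex.ofReal_add, hint hU hV lU lV t.isTest_D₁.isTest_D₁
      t.isTest_D₂.isTest_D₂ t.isTest_D₂.isTest_D₁]
    have := h₁ φ t
    push_cast
    exact this
  · rw [← Complex.ofReal_inj, Complex.ofReal_add, hint hV hU lV lU t.isTest_D₂.isTest_D₂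
      t.isTest_D₁.isTest_D₁ t.isTest_D₂.isTest_D₁]
    have := h₂ φ t
    push_cast
    exact this

theorem integral_lincomb {F G : ℝ × ℝ → ℂ} (hF : LocallyIntegrable F) (hG : LocallyIntegrable G)
    (c a b : ℂ) {φ : ℝ × ℝ → ℝ} (h : IsTest φ) :
    ∫ x, c * (a * F x - b * G x) * (φ x : ℂ)
      = c * (a * (∫ x, F x * (φ x : ℂ)) - b * ∫ x, G x * (φ x : ℂ)) := by
  have i₁ := (h.integrable_mul hF).const_mul a
  have i₂ := (h.integrable_mul hG).const_mul b
  rw [← integral_const_mul, ← integral_const_mul, ← integral_sub i₁ i₂, ← integral_const_mul]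
  congr 1
  funext x
  ring

theorem locallyIntegrable_lincomb {F G : ℝ × ℝ → ℂ} (hF : LocallyIntegrable F)
    (hG : LocallyIntegrable G) (c a b : ℂ) :
    LocallyIntegrable fun x => c * (a * F x - b * G x) :=
  ((hF.smul a).sub (hG.smul b)).smul c

/-! ### Reality of the force fields -/

theorem conj_log_r {s : ℂ} (hs : 0 < s.re) (x : ℝ × ℝ) :
    (starRingEnd ℂ) (Complex.log (r s x)) = Complex.log (r ((starRingEnd ℂ) s) x) := by
  have hc : (starRingEnd ℂ) (rsq s x) = rsq ((starRingEnd ℂ) s) x := by simp [rsq]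
  rw [log_r, log_r, map_div₀, ← hc]
  by_cases hx : x = 0
  · simp [hx, rsq]
  rw [Complex.log_conj _ (Complex.slitPlane_arg_ne_pi (rsq_mem_slitPlane hs hx)), map_ofNat]

theorem conj_Y1 (s : ℂ) : (starRingEnd ℂ) (Y1 lam mu mus s)
    = Y1 lam mu mus ((starRingEnd ℂ) s) := by
  simp [Y1, map_ofNat]

theorem conj_Y2 (s : ℂ) : (starRingEnd ℂ) (Y2 lam mu mus s)
    = Y2 lam mu mus ((starRingEnd ℂ) s) := by
  simp [Y2, map_ofNat]

theorem conj_arctan {z : ℂ} (h : z.re ≠ 0 ∨ |z.im| < 1) :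
    (starRingEnd ℂ) (Complex.arctan z) = Complex.arctan ((starRingEnd ℂ) z) := by
  have hslit := div_mem_slitPlane_of_arctan h
  simp only [Complex.arctan, map_mul]
  rw [← Complex.log_conj _ (Complex.slitPlane_arg_ne_pi hslit)]
  have e : (starRingEnd ℂ) ((1 + z * Complex.I) / (1 - z * Complex.I))
      = ((1 + (starRingEnd ℂ) z * Complex.I) / (1 - (starRingEnd ℂ) z * Complex.I))⁻¹ := by
    simp [sub_eq_add_neg]
  have h' : ((starRingEnd ℂ) z).re ≠ 0 ∨ |((starRingEnd ℂ) z).im| < 1 := by simpa using h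
  rw [e, Complex.log_inv _ (Complex.slitPlane_arg_ne_pi (div_mem_slitPlane_of_arctan h')),
    map_div₀, map_neg, Complex.conj_I, map_ofNat]
  ring

theorem conj_angle {s s' : ℂ} (hs : 0 < s.re) (h : s * s' = 1) (x : ℝ × ℝ) :
    (starRingEnd ℂ) (angle s s' x) = angle ((starRingEnd ℂ) s) ((starRingEnd ℂ) s') x := by
  rw [angle, conj_arctan (angle_arg_mem hs h x), angle]
  simp

theorem arctan_neg_of_mem {z : ℂ} (h : z.re ≠ 0 ∨ |z.im| < 1) :
    Complex.arctan (-z) = -Complex.arctan z := by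
  have e : (1 + -z * Complex.I) / (1 - -z * Complex.I)
      = ((1 + z * Complex.I) / (1 - z * Complex.I))⁻¹ := by
    rw [inv_div, neg_mul, sub_neg_eq_add, ← sub_eq_add_neg]
  rw [Complex.arctan, e, Complex.log_inv _ (Complex.slitPlane_arg_ne_pi
    (div_mem_slitPlane_of_arctan h)), Complex.arctan]
  ring

theorem angle_swap {s s' : ℂ} (hs : 0 < s.re) (h : s * s' = 1) (x : ℝ × ℝ) :
    angle s' s x = -angle s s' x := by
  rw [angle, angle, ← arctan_neg_of_mem (angle_arg_mem hs h x), ← neg_mul, neg_sub]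

theorem forceH₁_eq_ofReal (hmu : 0 < mu) (hlam : 0 < lam + mu) (hmus : 0 < mus) (hne : mus ≠ mu)
    (P : ℝ) (x : ℝ × ℝ) : forceH₁ lam mu mus P x = ((forceH lam mu mus P x).1 : ℂ) := by
  refine (Complex.conj_eq_iff_re.1 ?_).symm
  have l1 := conj_log_r (s₁_re_pos hmu hlam hmus hne) x
  have l2 := conj_log_r (s₂_re_pos hmu hlam hmus hne) x
  simp only [forceH₁, map_mul, map_sub, map_div₀, conj_Y1, l1, l2, Complex.conj_ofReal, map_ofNat]
  rcases conj_roots hmu hlam hmus hne with ⟨hw, h1, h2⟩ | ⟨hw, h1, h2⟩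
  · rw [hw, h1, h2]
  · rw [hw, h1, h2, mul_neg, div_neg]
    ring

theorem forceV₂_eq_ofReal (hmu : 0 < mu) (hlam : 0 < lam + mu) (hmus : 0 < mus) (hne : mus ≠ mu)
    (P : ℝ) (x : ℝ × ℝ) : forceV₂ lam mu mus P x = ((forceV lam mu mus P x).2 : ℂ) := by
  refine (Complex.conj_eq_iff_re.1 ?_).symm
  have l1 := conj_log_r (s₁_re_pos hmu hlam hmus hne) x
  have l2 := conj_log_r (s₂_re_pos hmu hlam hmus hne) x
  simp only [forceV₂, map_mul, map_sub, map_div₀, conj_Y2, l1, l2, Complex.conj_ofReal, map_ofNat]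
  rcases conj_roots hmu hlam hmus hne with ⟨hw, h1, h2⟩ | ⟨hw, h1, h2⟩
  · rw [hw, h1, h2]
  · rw [hw, h1, h2, mul_neg, div_neg]
    ring

theorem forceH₂_eq (hmu : 0 < mu) (hlam : 0 < lam + mu) (hmus : 0 < mus) (hne : mus ≠ mu)
    (P : ℝ) (x : ℝ × ℝ) :
    forceH₂ lam mu mus P x = P * (lam + mus) / (2 * Real.pi * sqrtq lam mu mus)
      * angle (s₁ lam mu mus) (s₂ lam mu mus) x := by
  rw [forceH₂, θ_sub_θ (s₁_re_pos hmu hlam hmus hne) (s₁_mul_s₂ hmu hlam hmus hne)]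

theorem forceH₂_eq_ofReal (hmu : 0 < mu) (hlam : 0 < lam + mu) (hmus : 0 < mus) (hne : mus ≠ mu)
    (P : ℝ) (x : ℝ × ℝ) : forceH₂ lam mu mus P x = ((forceH lam mu mus P x).2 : ℂ) := by
  refine (Complex.conj_eq_iff_re.1 ?_).symm
  have hs := s₁_re_pos hmu hlam hmus hne
  have hss := s₁_mul_s₂ hmu hlam hmus hne
  rw [forceH₂_eq hmu hlam hmus hne]
  simp only [map_mul, map_add, map_div₀, conj_angle hs hss, Complex.conj_ofReal, map_ofNat]
  rcases conj_roots hmu hlam hmus hne with ⟨hw, h1, h2⟩ | ⟨hw, h1, h2⟩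
  · rw [hw, h1, h2]
  · rw [hw, h1, h2, angle_swap hs hss, mul_neg (2 * (Real.pi : ℂ)), div_neg]
    ring

theorem forceV₁_eq (hmu : 0 < mu) (hlam : 0 < lam + mu) (hmus : 0 < mus) (hne : mus ≠ mu)
    (P : ℝ) (x : ℝ × ℝ) :
    forceV₁ lam mu mus P x = P * (lam + mus) / (2 * Real.pi * sqrtq lam mu mus)
      * angle (s₁ lam mu mus) (s₂ lam mu mus) x :=
  forceH₂_eq hmu hlam hmus hne P x

theorem forceV₁_eq_ofReal (hmu : 0 < mu) (hlam : 0 < lam + mu) (hmus : 0 < mus) (hne : mus ≠ mu)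
    (P : ℝ) (x : ℝ × ℝ) : forceV₁ lam mu mus P x = ((forceV lam mu mus P x).1 : ℂ) :=
  forceH₂_eq_ofReal hmu hlam hmus hne P x

/-! ### Equilibrium under the concentrated forces -/

theorem locallyIntegrable_forceH₁ (hmu : 0 < mu) (hlam : 0 < lam + mu) (hmus : 0 < mus)
    (hne : mus ≠ mu) (P : ℝ) : LocallyIntegrable (forceH₁ lam mu mus P) :=
  locallyIntegrable_lincomb (locallyIntegrable_log_r (s₁_re_pos hmu hlam hmus hne))
    (locallyIntegrable_log_r (s₂_re_pos hmu hlam hmus hne)) _ _ _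

theorem locallyIntegrable_forceV₂ (hmu : 0 < mu) (hlam : 0 < lam + mu) (hmus : 0 < mus)
    (hne : mus ≠ mu) (P : ℝ) : LocallyIntegrable (forceV₂ lam mu mus P) :=
  locallyIntegrable_lincomb (locallyIntegrable_log_r (s₁_re_pos hmu hlam hmus hne))
    (locallyIntegrable_log_r (s₂_re_pos hmu hlam hmus hne)) _ _ _

theorem locallyIntegrable_forceH₂ (hmu : 0 < mu) (hlam : 0 < lam + mu) (hmus : 0 < mus)
    (hne : mus ≠ mu) (P : ℝ) : LocallyIntegrable (forceH₂ lam mu mus P) := by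
  rw [funext (forceH₂_eq hmu hlam hmus hne P)]
  exact (locallyIntegrable_angle (s₁_re_pos hmu hlam hmus hne)
    (s₁_mul_s₂ hmu hlam hmus hne)).smul (P * (lam + mus) / (2 * Real.pi * sqrtq lam mu mus) : ℂ)

theorem force_amplitude (P : ℝ) {w : ℂ} (hw : w ≠ 0) :
    (P : ℂ) = P / (2 * Real.pi * w) * (2 * Real.pi * w) := by
  have : (Real.pi : ℂ) ≠ 0 := by exact_mod_cast Real.pi_ne_zero
  field_simp

theorem div_root_eq {s s' z : ℂ} (h : s * s' = 1) : z / s = z * s' := by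
  rw [div_eq_iff (left_ne_zero_of_mul_eq_one h)]
  linear_combination -z * h

/-- In the first equation the flux identity leaves the values `∫ K₁ ∂₁φ`, whose coefficients vanish
by the characteristic equation, and a multiple of `φ 0`. The second equation needs only the symmetry
`∂₂ K₁ = s² ∂₁ K₂`, so no point source appears. -/
theorem isForceSolution_forceH (hmu : 0 < mu) (hlam : 0 < lam + mu) (hmus : 0 < mus)
    (hne : mus ≠ mu) (P : ℝ) : IsForceSolution lam mu mus P 0 (forceH lam mu mus P) := by
  have hs := s₁_re_pos hmu hlam hmus hne
  have hs' := s₂_re_pos hmu hlam hmus hne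
  have hss := s₁_mul_s₂ hmu hlam hmus hne
  have hw := sqrtq_ne_zero hmu hlam hmus hne
  have hsub := s₁_sq_sub_s₂_sq hmu hlam hmus
  have hadd := s₁_sq_add_s₂_sq hmu hlam hmus
  have hP := force_amplitude P hw
  have hk := mul_div_right_comm (P : ℂ) (lam + mus) (2 * Real.pi * sqrtq lam mu mus)
  have hH₁ : ∀ φ, IsTest φ → ∫ x, forceH₁ lam mu mus P x * (φ x : ℂ) = _ := fun φ t =>
    integral_lincomb (locallyIntegrable_log_r hs) (locallyIntegrable_log_r hs') _ _ _ t
  have hH₂ : ∀ φ, IsTest φ → ∫ x, forceH₂ lam mu mus P x * (φ x : ℂ)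
      = P * (lam + mus) / (2 * Real.pi * sqrtq lam mu mus)
        * ∫ x, angle (s₁ lam mu mus) (s₂ lam mu mus) x * (φ x : ℂ) := fun φ t => by
    rw [← integral_const_mul]
    simp only [forceH₂_eq hmu hlam hmus hne, mul_assoc]
  refine isEquilibrium_of_complex (forceH₁_eq_ofReal hmu hlam hmus hne P)
    (forceH₂_eq_ofReal hmu hlam hmus hne P) (locallyIntegrable_forceH₁ hmu hlam hmus hne P)
    (locallyIntegrable_forceH₂ hmu hlam hmus hne P) (fun φ t => ?_) (fun φ t => ?_)
  · have hflux := integral_K₁_mul_D₁_add_K₂_mul_D₂ hs t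
    have hflux' := integral_K₁_mul_D₁_add_K₂_mul_D₂ hs' t
    rw [hH₁ _ t.isTest_D₁.isTest_D₁, hH₁ _ t.isTest_D₂.isTest_D₂, hH₂ _ t.isTest_D₂.isTest_D₁,
      integral_log_r_mul_D₁ hs t.isTest_D₁, integral_log_r_mul_D₁ hs' t.isTest_D₁,
      integral_log_r_mul_D₂ hs t.isTest_D₂, integral_log_r_mul_D₂ hs' t.isTest_D₂]
    simp only [t.D₁_D₂]
    rw [integral_angle_mul_D₂ hs hss t.isTest_D₁, Y1_eq hss, Y1_eq ((mul_comm _ _).trans hss),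
      eq_sub_of_add_eq' hflux, eq_sub_of_add_eq' hflux']
    generalize (∫ x, K₁ (s₁ lam mu mus) x * (D₁ φ x : ℂ)) = a
    generalize (∫ x, K₁ (s₂ lam mu mus) x * (D₁ φ x : ℂ)) = a'
    rw [hk, div_root_eq hss, div_root_eq ((mul_comm _ _).trans hss)]
    generalize (P : ℂ) / (2 * Real.pi * sqrtq lam mu mus) = c at hP ⊢
    push_cast
    linear_combination c * a * (s₁ lam mu mus * hadd
        - ((lam + 2 * mu) * mus * s₂ lam mu mus + mus ^ 2 * s₁ lam mu mus) * hss)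
      - c * a' * (s₂ lam mu mus * hadd
        - ((lam + 2 * mu) * mus * s₁ lam mu mus + mus ^ 2 * s₂ lam mu mus) * hss)
      + c * (2 * Real.pi) * (φ 0 : ℂ) * (s₁ lam mu mus * s₂ lam mu mus * hsub
        - sqrtq lam mu mus * hss) + (φ 0 : ℂ) * hP
  · have hcross := integral_K₁_mul_D₂ hs t
    have hcross' := integral_K₁_mul_D₂ hs' t
    rw [hH₂ _ t.isTest_D₁.isTest_D₁, hH₂ _ t.isTest_D₂.isTest_D₂, hH₁ _ t.isTest_D₂.isTest_D₁,
      integral_angle_mul_D₁ hs hss t.isTest_D₁, integral_angle_mul_D₂ hs hss t.isTest_D₂,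
      integral_log_r_mul_D₁ hs t.isTest_D₂, integral_log_r_mul_D₁ hs' t.isTest_D₂,
      Y1_eq hss, Y1_eq ((mul_comm _ _).trans hss), hcross, hcross']
    generalize (∫ x, K₂ (s₁ lam mu mus) x * (D₁ φ x : ℂ)) = b
    generalize (∫ x, K₂ (s₂ lam mu mus) x * (D₁ φ x : ℂ)) = b'
    rw [hk]
    generalize (P : ℂ) / (2 * Real.pi * sqrtq lam mu mus) = c
    push_cast
    linear_combination c * (lam + mus) * mus
      * (b * s₁ lam mu mus - b' * s₂ lam mu mus) * hss

/-- The analogue of `isForceSolution_forceH`, with the roles of the two equations exchanged. -/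
theorem isForceSolution_forceV (hmu : 0 < mu) (hlam : 0 < lam + mu) (hmus : 0 < mus)
    (hne : mus ≠ mu) (P : ℝ) : IsForceSolution lam mu mus 0 P (forceV lam mu mus P) := by
  have hs := s₁_re_pos hmu hlam hmus hne
  have hs' := s₂_re_pos hmu hlam hmus hne
  have hss := s₁_mul_s₂ hmu hlam hmus hne
  have hw := sqrtq_ne_zero hmu hlam hmus hne
  have hsub := s₁_sq_sub_s₂_sq hmu hlam hmus
  have hadd := s₁_sq_add_s₂_sq hmu hlam hmus
  have hP := force_amplitude P hw
  have hk := mul_div_right_comm (P : ℂ) (lam + mus) (2 * Real.pi * sqrtq lam mu mus)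
  have hV₂ : ∀ φ, IsTest φ → ∫ x, forceV₂ lam mu mus P x * (φ x : ℂ) = _ := fun φ t =>
    integral_lincomb (locallyIntegrable_log_r hs) (locallyIntegrable_log_r hs') _ _ _ t
  have hV₁ : ∀ φ, IsTest φ → ∫ x, forceV₁ lam mu mus P x * (φ x : ℂ)
      = P * (lam + mus) / (2 * Real.pi * sqrtq lam mu mus)
        * ∫ x, angle (s₁ lam mu mus) (s₂ lam mu mus) x * (φ x : ℂ) := fun φ t => by
    rw [← integral_const_mul]
    simp only [forceV₁_eq hmu hlam hmus hne, mul_assoc]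
  refine isEquilibrium_of_complex (forceV₁_eq_ofReal hmu hlam hmus hne P)
    (forceV₂_eq_ofReal hmu hlam hmus hne P) (locallyIntegrable_forceH₂ hmu hlam hmus hne P)
    (locallyIntegrable_forceV₂ hmu hlam hmus hne P) (fun φ t => ?_) (fun φ t => ?_)
  · have hcross := integral_K₁_mul_D₂ hs t
    have hcross' := integral_K₁_mul_D₂ hs' t
    rw [hV₁ _ t.isTest_D₁.isTest_D₁, hV₁ _ t.isTest_D₂.isTest_D₂, hV₂ _ t.isTest_D₂.isTest_D₁,
      integral_angle_mul_D₁ hs hss t.isTest_D₁, integral_angle_mul_D₂ hs hss t.isTest_D₂,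
      integral_log_r_mul_D₁ hs t.isTest_D₂, integral_log_r_mul_D₁ hs' t.isTest_D₂,
      Y2_eq hss, Y2_eq ((mul_comm _ _).trans hss), hcross, hcross']
    generalize (∫ x, K₂ (s₁ lam mu mus) x * (D₁ φ x : ℂ)) = b
    generalize (∫ x, K₂ (s₂ lam mu mus) x * (D₁ φ x : ℂ)) = b'
    rw [hk]
    generalize (P : ℂ) / (2 * Real.pi * sqrtq lam mu mus) = c
    push_cast
    linear_combination c * (lam + mus) * (lam + 2 * mu)
      * (b * s₁ lam mu mus - b' * s₂ lam mu mus) * hss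
  · have hflux := integral_K₁_mul_D₁_add_K₂_mul_D₂ hs t
    have hflux' := integral_K₁_mul_D₁_add_K₂_mul_D₂ hs' t
    rw [hV₂ _ t.isTest_D₁.isTest_D₁, hV₂ _ t.isTest_D₂.isTest_D₂, hV₁ _ t.isTest_D₂.isTest_D₁,
      integral_log_r_mul_D₁ hs t.isTest_D₁, integral_log_r_mul_D₁ hs' t.isTest_D₁,
      integral_log_r_mul_D₂ hs t.isTest_D₂, integral_log_r_mul_D₂ hs' t.isTest_D₂]
    simp only [t.D₁_D₂]
    rw [integral_angle_mul_D₂ hs hss t.isTest_D₁, Y2_eq hss, Y2_eq ((mul_comm _ _).trans hss),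
      eq_sub_of_add_eq' hflux, eq_sub_of_add_eq' hflux']
    generalize (∫ x, K₁ (s₁ lam mu mus) x * (D₁ φ x : ℂ)) = a
    generalize (∫ x, K₁ (s₂ lam mu mus) x * (D₁ φ x : ℂ)) = a'
    rw [hk, div_root_eq hss, div_root_eq ((mul_comm _ _).trans hss)]
    generalize (P : ℂ) / (2 * Real.pi * sqrtq lam mu mus) = c at hP ⊢
    push_cast
    linear_combination c * a * (s₁ lam mu mus * hadd
        - ((lam + 2 * mu) ^ 2 * s₁ lam mu mus + mus * (lam + 2 * mu) * s₂ lam mu mus) * hss)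
      - c * a' * (s₂ lam mu mus * hadd
        - ((lam + 2 * mu) ^ 2 * s₂ lam mu mus + mus * (lam + 2 * mu) * s₁ lam mu mus) * hss)
      + c * (2 * Real.pi) * (φ 0 : ℂ) * (s₁ lam mu mus * s₂ lam mu mus * hsub
        - sqrtq lam mu mus * hss) + (φ 0 : ℂ) * hP

/-! ### The concentrated couple -/

theorem four_pi_mul_ne_zero {w : ℂ} (hw : w ≠ 0) : (4 * Real.pi * w : ℂ) ≠ 0 :=
  mul_ne_zero (mul_ne_zero (by norm_num) (by exact_mod_cast Real.pi_ne_zero)) hw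

/-- Since `μ* (λ + 2 μ) (s₁² - s₂²) = -√q`, the last term of `couple₁` replaces `s₁² / r₁²` by
`s₂² / r₂²` next to `Y⁽¹⁾` of `s₂`, which makes the expression antisymmetric in the two roots. -/
theorem couple₁_eq (hmu : 0 < mu) (hlam : 0 < lam + mu) (hmus : 0 < mus) (hne : mus ≠ mu)
    (x : ℝ × ℝ) : couple₁ lam mu mus x = 1 / (4 * Real.pi * sqrtq lam mu mus) *
      (s₁ lam mu mus * ((lam + 2 * mu) * s₁ lam mu mus ^ 2 - (lam + 2 * mus))
          * K₂ (s₁ lam mu mus) x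
        - s₂ lam mu mus * ((lam + 2 * mu) * s₂ lam mu mus ^ 2 - (lam + 2 * mus))
          * K₂ (s₂ lam mu mus) x) := by
  by_cases hx : x = 0
  · simp [couple₁, K₂, hx]
  have hss := s₁_mul_s₂ hmu hlam hmus hne
  have hw := sqrtq_ne_zero hmu hlam hmus hne
  have hsub := s₁_sq_sub_s₂_sq hmu hlam hmus
  have n1 := rsq_ne_zero (s₁_re_pos hmu hlam hmus hne) hx
  have n2 := rsq_ne_zero (s₂_re_pos hmu hlam hmus hne) hx
  have hm : (mus : ℂ) ≠ 0 := by exact_mod_cast hmus.ne'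
  have hC : (lam + 2 * mu : ℂ) ≠ 0 := by
    exact_mod_cast (by linarith : 0 < lam + 2 * mu).ne'
  have h2 : (s₁ lam mu mus ^ 2 - s₂ lam mu mus ^ 2)
      * (x.1 ^ 2 * x.2 / (rsq (s₁ lam mu mus) x * rsq (s₂ lam mu mus) x))
      = x.2 * (s₁ lam mu mus ^ 2 / rsq (s₁ lam mu mus) x
        - s₂ lam mu mus ^ 2 / rsq (s₂ lam mu mus) x) := by
    rw [div_sub_div _ _ n1 n2, mul_div_assoc', mul_div_assoc']
    congr 1
    simp only [rsq]
    ring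
  have hg : (4 * Real.pi * mus * (lam + 2 * mu) : ℂ)⁻¹
      = -(s₁ lam mu mus ^ 2 - s₂ lam mu mus ^ 2) * (4 * Real.pi * sqrtq lam mu mus)⁻¹ := by
    rw [← div_eq_mul_inv, eq_div_iff (four_pi_mul_ne_zero hw), mul_assoc (4 * (Real.pi : ℂ)),
      inv_mul_eq_iff_eq_mul₀ (four_pi_mul_ne_zero (mul_ne_zero hm hC))]
    linear_combination 4 * Real.pi * hsub
  rw [couple₁, Y1_eq hss, Y1_eq ((mul_comm _ _).trans hss)]
  simp only [K₂]
  rw [div_eq_mul_inv _ (4 * Real.pi * mus * (lam + 2 * mu) : ℂ), hg]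
  linear_combination ((lam + 2 * mu) * s₂ lam mu mus - mus * s₁ lam mu mus)
      * (4 * Real.pi * sqrtq lam mu mus)⁻¹ * h2
    + x.2 * (4 * Real.pi * sqrtq lam mu mus)⁻¹ * mus
      * (s₂ lam mu mus / rsq (s₂ lam mu mus) x - s₁ lam mu mus / rsq (s₁ lam mu mus) x) * hss

theorem couple₂_eq (hmu : 0 < mu) (hlam : 0 < lam + mu) (hmus : 0 < mus) (hne : mus ≠ mu)
    (x : ℝ × ℝ) : couple₂ lam mu mus x = 1 / (4 * Real.pi * sqrtq lam mu mus) *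
      (((lam + 2 * mus) * s₂ lam mu mus - (lam + 2 * mu) * s₁ lam mu mus) * K₁ (s₂ lam mu mus) x
        - ((lam + 2 * mus) * s₁ lam mu mus - (lam + 2 * mu) * s₂ lam mu mus)
          * K₁ (s₁ lam mu mus) x) := by
  have hss := s₁_mul_s₂ hmu hlam hmus hne
  rw [couple₂, Y2_eq hss, Y2_eq ((mul_comm _ _).trans hss)]
  simp only [K₁]
  ring

/-! ### A closed form of the couple in real quantities -/

/-- The sum `s₁² + s₂²` as a real number. -/
def rootSum (lam mu mus : ℝ) : ℝ :=
  ((lam + 2 * mu) ^ 2 + mus ^ 2 - (lam + mus) ^ 2) / (mus * (lam + 2 * mu))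

/-- The common denominator `4 π μ* (λ + 2 μ) (s₁ + s₂) r₁² r₂²` of the couple field. -/
def coupleDenom (lam mu mus : ℝ) (x : ℝ × ℝ) : ℝ :=
  4 * Real.pi * (mus * (lam + 2 * mu)) * √(rootSum lam mu mus + 2)
    * (x.1 ^ 4 + x.2 ^ 4 + rootSum lam mu mus * (x.1 ^ 2 * x.2 ^ 2))

/-- The couple field written with the symmetric functions of the characteristic roots, which are
real and depend continuously on `mus`, also at `mus = mu`. -/
def coupleReal (lam mu mus : ℝ) (x : ℝ × ℝ) : ℝ × ℝ :=
  (-(x.2 * (x.1 ^ 2 * ((lam + 2 * mu) * (rootSum lam mu mus + 1) - (lam + 2 * mus))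
      + x.2 ^ 2 * ((lam + 2 * mu) + (lam + 2 * mus)))) / coupleDenom lam mu mus x,
    x.1 * (x.1 ^ 2 * ((lam + 2 * mu) + (lam + 2 * mus))
      + x.2 ^ 2 * ((lam + 2 * mu) * (rootSum lam mu mus + 1) - (lam + 2 * mus)))
      / coupleDenom lam mu mus x)

theorem eq_ofReal_sqrt {z : ℂ} {a : ℝ} (h : z ^ 2 = (a : ℂ)) (hz : 0 < z.re) : z = (√a : ℝ) := by
  have hre : z.re ^ 2 - z.im ^ 2 = a := by
    have := congrArg Complex.re h
    simp [pow_two] at this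
    linarith
  have him : z.re * z.im = 0 := by
    have := congrArg Complex.im h
    simp [pow_two] at this
    linarith
  have h0 : z.im = 0 := (mul_eq_zero.1 him).resolve_left hz.ne'
  refine Complex.ext ?_ (by simpa using h0)
  rw [Complex.ofReal_re, ← hre, h0, zero_pow two_ne_zero, sub_zero, Real.sqrt_sq hz.le]

theorem s₁_sq_add_s₂_sq_eq_rootSum (hmu : 0 < mu) (hlam : 0 < lam + mu) (hmus : 0 < mus) :
    s₁ lam mu mus ^ 2 + s₂ lam mu mus ^ 2 = (rootSum lam mu mus : ℂ) := by
  have h := s₁_sq_add_s₂_sq hmu hlam hmus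
  have hm : (mus : ℂ) ≠ 0 := by exact_mod_cast hmus.ne'
  have hC : (lam + 2 * mu : ℂ) ≠ 0 := by
    exact_mod_cast (by linarith : 0 < lam + 2 * mu).ne'
  rw [rootSum]
  push_cast
  rw [eq_div_iff (mul_ne_zero hm hC), ← h]
  ring

/-- The sum of the roots is real in both cases, as it has a real square and positive real part. -/
theorem s₁_add_s₂ (hmu : 0 < mu) (hlam : 0 < lam + mu) (hmus : 0 < mus) (hne : mus ≠ mu) :
    s₁ lam mu mus + s₂ lam mu mus = (√(rootSum lam mu mus + 2) : ℝ) := by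
  refine eq_ofReal_sqrt ?_ ?_
  · push_cast
    rw [← s₁_sq_add_s₂_sq_eq_rootSum hmu hlam hmus]
    linear_combination 2 * s₁_mul_s₂ hmu hlam hmus hne
  · rw [Complex.add_re]
    exact add_pos (s₁_re_pos hmu hlam hmus hne) (s₂_re_pos hmu hlam hmus hne)

/-- The common factor `s₁ - s₂` is split off from `√q = -μ* (λ + 2 μ) (s₁ - s₂) (s₁ + s₂)`. -/
theorem coupleDenom_eq (hmu : 0 < mu) (hlam : 0 < lam + mu) (hmus : 0 < mus) (hne : mus ≠ mu)
    (x : ℝ × ℝ) : (coupleDenom lam mu mus x : ℂ) * (s₁ lam mu mus - s₂ lam mu mus)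
      = -(4 * Real.pi * sqrtq lam mu mus)
        * (rsq (s₁ lam mu mus) x * rsq (s₂ lam mu mus) x) := by
  have hss := s₁_mul_s₂ hmu hlam hmus hne
  have hsub := s₁_sq_sub_s₂_sq hmu hlam hmus
  have hR : rsq (s₁ lam mu mus) x * rsq (s₂ lam mu mus) x
      = x.1 ^ 4 + x.2 ^ 4 + rootSum lam mu mus * (x.1 ^ 2 * x.2 ^ 2) := by
    rw [← s₁_sq_add_s₂_sq_eq_rootSum hmu hlam hmus]
    simp only [rsq]
    linear_combination (x.2 : ℂ) ^ 4 * (s₁ lam mu mus * s₂ lam mu mus + 1) * hss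
  rw [hR, coupleDenom]
  push_cast
  rw [← s₁_add_s₂ hmu hlam hmus hne]
  linear_combination 4 * Real.pi
    * (x.1 ^ 4 + x.2 ^ 4 + rootSum lam mu mus * (x.1 ^ 2 * x.2 ^ 2)) * hsub

theorem coupleDenom_ne_zero (hmu : 0 < mu) (hlam : 0 < lam + mu) (hmus : 0 < mus) (hne : mus ≠ mu)
    {x : ℝ × ℝ} (hx : x ≠ 0) : (coupleDenom lam mu mus x : ℂ) ≠ 0 := by
  intro h
  have h1 := coupleDenom_eq hmu hlam hmus hne x
  have hw := sqrtq_ne_zero hmu hlam hmus hne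
  have n1 := rsq_ne_zero (s₁_re_pos hmu hlam hmus hne) hx
  have n2 := rsq_ne_zero (s₂_re_pos hmu hlam hmus hne) hx
  rw [h, zero_mul] at h1
  exact mul_ne_zero (neg_ne_zero.2 (four_pi_mul_ne_zero hw)) (mul_ne_zero n1 n2) h1.symm

theorem couple₁_eq_coupleReal (hmu : 0 < mu) (hlam : 0 < lam + mu) (hmus : 0 < mus)
    (hne : mus ≠ mu) (x : ℝ × ℝ) :
    couple₁ lam mu mus x = ((coupleReal lam mu mus x).1 : ℂ) := by
  by_cases hx : x = 0
  · simp [couple₁, coupleReal, hx]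
  have hss := s₁_mul_s₂ hmu hlam hmus hne
  have hD := coupleDenom_eq hmu hlam hmus hne x
  have hD0 := coupleDenom_ne_zero hmu hlam hmus hne hx
  have hw := sqrtq_ne_zero hmu hlam hmus hne
  have n1 := rsq_ne_zero (s₁_re_pos hmu hlam hmus hne) hx
  have n2 := rsq_ne_zero (s₂_re_pos hmu hlam hmus hne) hx
  rw [couple₁_eq hmu hlam hmus hne, coupleReal, K₂, K₂, mul_div_assoc', mul_div_assoc',
    div_sub_div _ _ n1 n2, div_mul_div_comm, Complex.ofReal_div,
    div_eq_div_iff (mul_ne_zero (four_pi_mul_ne_zero hw) (mul_ne_zero n1 n2)) hD0]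
  push_cast
  rw [← s₁_sq_add_s₂_sq_eq_rootSum hmu hlam hmus]
  simp only [rsq] at hD ⊢
  linear_combination x.2
      * (x.1 ^ 2 * ((lam + 2 * mu) * (s₁ lam mu mus ^ 2 + s₂ lam mu mus ^ 2 + 1) - (lam + 2 * mus))
      + x.2 ^ 2 * ((lam + 2 * mu) + (lam + 2 * mus))) * hD
    + coupleDenom lam mu mus x * x.2 * (s₁ lam mu mus - s₂ lam mu mus)
      * (x.1 ^ 2 * (lam + 2 * mu)
      + x.2 ^ 2 * ((lam + 2 * mu) * (s₁ lam mu mus * s₂ lam mu mus + 1) + (lam + 2 * mus)))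
      * hss

theorem couple₂_eq_coupleReal (hmu : 0 < mu) (hlam : 0 < lam + mu) (hmus : 0 < mus)
    (hne : mus ≠ mu) (x : ℝ × ℝ) :
    couple₂ lam mu mus x = ((coupleReal lam mu mus x).2 : ℂ) := by
  by_cases hx : x = 0
  · simp [couple₂, coupleReal, hx]
  have hss := s₁_mul_s₂ hmu hlam hmus hne
  have hD := coupleDenom_eq hmu hlam hmus hne x
  have hD0 := coupleDenom_ne_zero hmu hlam hmus hne hx
  have hw := sqrtq_ne_zero hmu hlam hmus hne
  have n1 := rsq_ne_zero (s₁_re_pos hmu hlam hmus hne) hx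
  have n2 := rsq_ne_zero (s₂_re_pos hmu hlam hmus hne) hx
  rw [couple₂_eq hmu hlam hmus hne, coupleReal, K₁, K₁, mul_div_assoc', mul_div_assoc',
    div_sub_div _ _ n2 n1, div_mul_div_comm, Complex.ofReal_div,
    div_eq_div_iff (mul_ne_zero (four_pi_mul_ne_zero hw) (mul_ne_zero n2 n1)) hD0]
  push_cast
  rw [← s₁_sq_add_s₂_sq_eq_rootSum hmu hlam hmus]
  simp only [rsq] at hD ⊢
  linear_combination -x.1
      * (x.1 ^ 2 * ((lam + 2 * mu) + (lam + 2 * mus))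
      + x.2 ^ 2 * ((lam + 2 * mu) * (s₁ lam mu mus ^ 2 + s₂ lam mu mus ^ 2 + 1) - (lam + 2 * mus)))
      * hD
    + coupleDenom lam mu mus x * x.1 * x.2 ^ 2 * ((lam + 2 * mus) - (lam + 2 * mu))
      * (s₁ lam mu mus - s₂ lam mu mus) * hss

theorem couple₁_eq_ofReal (hmu : 0 < mu) (hlam : 0 < lam + mu) (hmus : 0 < mus)
    (hne : mus ≠ mu) (x : ℝ × ℝ) : couple₁ lam mu mus x = ((couple lam mu mus x).1 : ℂ) := by
  rw [couple, couple₁_eq_coupleReal hmu hlam hmus hne, Complex.ofReal_re]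

theorem couple₂_eq_ofReal (hmu : 0 < mu) (hlam : 0 < lam + mu) (hmus : 0 < mus)
    (hne : mus ≠ mu) (x : ℝ × ℝ) : couple₂ lam mu mus x = ((couple lam mu mus x).2 : ℂ) := by
  rw [couple, couple₂_eq_coupleReal hmu hlam hmus hne, Complex.ofReal_re]

theorem couple_eq_coupleReal (hmu : 0 < mu) (hlam : 0 < lam + mu) (hmus : 0 < mus)
    (hne : mus ≠ mu) (x : ℝ × ℝ) : couple lam mu mus x = coupleReal lam mu mus x := by
  rw [couple, couple₁_eq_coupleReal hmu hlam hmus hne, couple₂_eq_coupleReal hmu hlam hmus hne,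
    Complex.ofReal_re, Complex.ofReal_re]

/-! ### Equilibrium under the couple -/

/-- The symmetry and flux identities are applied with the test functions `∂₁φ` and `∂₂φ`; the point
values of these first derivatives give the couple. -/
theorem isUnitCoupleSolution_couple (hmu : 0 < mu) (hlam : 0 < lam + mu) (hmus : 0 < mus)
    (hne : mus ≠ mu) : IsUnitCoupleSolution lam mu mus (couple lam mu mus) := by
  have hs := s₁_re_pos hmu hlam hmus hne
  have hs' := s₂_re_pos hmu hlam hmus hne
  have hss := s₁_mul_s₂ hmu hlam hmus hne
  have hw := sqrtq_ne_zero hmu hlam hmus hne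
  have hsub := s₁_sq_sub_s₂_sq hmu hlam hmus
  have hadd := s₁_sq_add_s₂_sq hmu hlam hmus
  have hg : 1 / (4 * Real.pi * sqrtq lam mu mus) * (4 * Real.pi * sqrtq lam mu mus) = 1 :=
    one_div_mul_cancel (four_pi_mul_ne_zero hw)
  have h₁ : ∀ φ, IsTest φ → ∫ x, couple₁ lam mu mus x * (φ x : ℂ) = _ := fun φ t => by
    simp only [couple₁_eq hmu hlam hmus hne]
    exact integral_lincomb (locallyIntegrable_K₂ hs) (locallyIntegrable_K₂ hs') _ _ _ t
  have h₂ : ∀ φ, IsTest φ → ∫ x, couple₂ lam mu mus x * (φ x : ℂ) = _ := fun φ t => by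
    simp only [couple₂_eq hmu hlam hmus hne]
    exact integral_lincomb (locallyIntegrable_K₁ hs') (locallyIntegrable_K₁ hs) _ _ _ t
  refine isEquilibrium_of_complex (couple₁_eq_ofReal hmu hlam hmus hne)
    (couple₂_eq_ofReal hmu hlam hmus hne) ?_ ?_ (fun φ t => ?_) (fun φ t => ?_)
  · rw [funext (couple₁_eq hmu hlam hmus hne)]
    exact locallyIntegrable_lincomb (locallyIntegrable_K₂ hs) (locallyIntegrable_K₂ hs') _ _ _
  · rw [funext (couple₂_eq hmu hlam hmus hne)]
    exact locallyIntegrable_lincomb (locallyIntegrable_K₁ hs') (locallyIntegrable_K₁ hs) _ _ _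
  · rw [h₁ _ t.isTest_D₁.isTest_D₁, h₁ _ t.isTest_D₂.isTest_D₂, h₂ _ t.isTest_D₂.isTest_D₁]
    have hflux := integral_K₁_mul_D₁_add_K₂_mul_D₂ hs t.isTest_D₂
    have hflux' := integral_K₁_mul_D₁_add_K₂_mul_D₂ hs' t.isTest_D₂
    have hcross := integral_K₁_mul_D₂ hs t.isTest_D₁
    have hcross' := integral_K₁_mul_D₂ hs' t.isTest_D₁
    rw [eq_sub_of_add_eq' hflux, eq_sub_of_add_eq' hflux']
    simp only [t.D₁_D₂]
    rw [hcross, hcross', div_root_eq hss, div_root_eq ((mul_comm _ _).trans hss)]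
    generalize (∫ x, K₂ (s₁ lam mu mus) x * (D₁ (D₁ φ) x : ℂ)) = e
    generalize (∫ x, K₂ (s₂ lam mu mus) x * (D₁ (D₁ φ) x : ℂ)) = e'
    generalize 1 / (4 * Real.pi * sqrtq lam mu mus) = g at hg ⊢
    push_cast
    linear_combination g * e * (-s₁ lam mu mus ^ 3 * hadd + (lam + 2 * mu) * s₁ lam mu mus
        * ((lam + mus) + mus * (s₁ lam mu mus * s₂ lam mu mus + 1)) * hss)
      - g * e' * (-s₂ lam mu mus ^ 3 * hadd + (lam + 2 * mu) * s₂ lam mu mus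
        * ((lam + mus) + mus * (s₂ lam mu mus * s₁ lam mu mus + 1)) * hss)
      - 2 * Real.pi * g * D₂ φ 0 * (s₁ lam mu mus * s₂ lam mu mus * hsub - sqrtq lam mu mus * hss)
      + 1 / 2 * D₂ φ 0 * hg
  · rw [h₂ _ t.isTest_D₂.isTest_D₂, h₂ _ t.isTest_D₁.isTest_D₁, h₁ _ t.isTest_D₂.isTest_D₁]
    have hflux := integral_K₁_mul_D₁_add_K₂_mul_D₂ hs t.isTest_D₁
    have hflux' := integral_K₁_mul_D₁_add_K₂_mul_D₂ hs' t.isTest_D₁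
    have hcross := integral_K₁_mul_D₂ hs t.isTest_D₂
    have hcross' := integral_K₁_mul_D₂ hs' t.isTest_D₂
    simp only [← t.D₁_D₂] at hflux hflux'
    rw [eq_sub_of_add_eq hflux, eq_sub_of_add_eq hflux', hcross, hcross',
      div_root_eq hss, div_root_eq ((mul_comm _ _).trans hss)]
    generalize (∫ x, K₂ (s₁ lam mu mus) x * (D₁ (D₂ φ) x : ℂ)) = e
    generalize (∫ x, K₂ (s₂ lam mu mus) x * (D₁ (D₂ φ) x : ℂ)) = e'
    generalize 1 / (4 * Real.pi * sqrtq lam mu mus) = g at hg ⊢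
    push_cast
    linear_combination g * e * (-s₁ lam mu mus * hadd
        + (lam + 2 * mu) * ((lam + 2 * mu) * s₁ lam mu mus + mus * s₂ lam mu mus) * hss)
      - g * e' * (-s₂ lam mu mus * hadd
        + (lam + 2 * mu) * ((lam + 2 * mu) * s₂ lam mu mus + mus * s₁ lam mu mus) * hss)
      + 2 * Real.pi * g * D₁ φ 0 * hsub - 1 / 2 * D₁ φ 0 * hg

/-! ### The couple as the derivative of the dipoles -/

/-- The derivative `∂₂` of the displacement of the unit horizontal force. -/
def forceHDeriv (lam mu mus : ℝ) (x : ℝ × ℝ) : ℝ × ℝ :=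
  ((1 / (2 * Real.pi * sqrtq lam mu mus) *
      (Y1 lam mu mus (s₁ lam mu mus) * (s₁ lam mu mus ^ 2 * K₂ (s₁ lam mu mus) x)
        - Y1 lam mu mus (s₂ lam mu mus) * (s₂ lam mu mus ^ 2 * K₂ (s₂ lam mu mus) x))).re,
    ((lam + mus) / (2 * Real.pi * sqrtq lam mu mus) *
      (s₂ lam mu mus * K₁ (s₂ lam mu mus) x - s₁ lam mu mus * K₁ (s₁ lam mu mus) x)).re)

/-- The derivative `∂₁` of the displacement of the unit vertical force. -/
def forceVDeriv (lam mu mus : ℝ) (x : ℝ × ℝ) : ℝ × ℝ :=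
  (((lam + mus) / (2 * Real.pi * sqrtq lam mu mus) *
      (s₁ lam mu mus * K₂ (s₁ lam mu mus) x - s₂ lam mu mus * K₂ (s₂ lam mu mus) x)).re,
    (1 / (2 * Real.pi * sqrtq lam mu mus) *
      (Y2 lam mu mus (s₁ lam mu mus) * K₁ (s₁ lam mu mus) x
        - Y2 lam mu mus (s₂ lam mu mus) * K₁ (s₂ lam mu mus) x)).re)

theorem hasDerivAt_re {f : ℝ → ℂ} {f' : ℂ} {t : ℝ} (h : HasDerivAt f f' t) :
    HasDerivAt (fun t => (f t).re) f'.re t :=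
  (Complex.reCLM.hasFDerivAt (x := f t)).comp_hasDerivAt t h

theorem hasDerivAt_forceH (hmu : 0 < mu) (hlam : 0 < lam + mu) (hmus : 0 < mus) (hne : mus ≠ mu)
    {x : ℝ × ℝ} (hx : x ≠ 0) :
    HasDerivAt (fun t => forceH lam mu mus 1 (x.1, t)) (forceHDeriv lam mu mus x) x.2 := by
  have hs := s₁_re_pos hmu hlam hmus hne
  have hs' := s₂_re_pos hmu hlam hmus hne
  have hss := s₁_mul_s₂ hmu hlam hmus hne
  refine HasDerivAt.prodMk (hasDerivAt_re ?_) (hasDerivAt_re ?_)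
  · simp only [forceH₁, Complex.ofReal_one]
    exact (((hasDerivAt_log_r_snd hs hx).const_mul _).sub
      ((hasDerivAt_log_r_snd hs' hx).const_mul _)).const_mul _
  · simp only [forceH₂_eq hmu hlam hmus hne, Complex.ofReal_one, one_mul]
    exact (hasDerivAt_angle_snd hs hss hx).const_mul _

theorem hasDerivAt_forceV (hmu : 0 < mu) (hlam : 0 < lam + mu) (hmus : 0 < mus) (hne : mus ≠ mu)
    {x : ℝ × ℝ} (hx : x ≠ 0) :
    HasDerivAt (fun t => forceV lam mu mus 1 (t, x.2)) (forceVDeriv lam mu mus x) x.1 := by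
  have hs := s₁_re_pos hmu hlam hmus hne
  have hs' := s₂_re_pos hmu hlam hmus hne
  have hss := s₁_mul_s₂ hmu hlam hmus hne
  refine HasDerivAt.prodMk (hasDerivAt_re ?_) (hasDerivAt_re ?_)
  · simp only [forceV₁_eq hmu hlam hmus hne, Complex.ofReal_one, one_mul]
    exact (hasDerivAt_angle_fst hs hss hx).const_mul _
  · simp only [forceV₂, Complex.ofReal_one]
    exact (((hasDerivAt_log_r_fst hs hx).const_mul _).sub
      ((hasDerivAt_log_r_fst hs' hx).const_mul _)).const_mul _

theorem continuousAt_forceHDeriv (hmu : 0 < mu) (hlam : 0 < lam + mu) (hmus : 0 < mus)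
    (hne : mus ≠ mu) {x : ℝ × ℝ} (hx : x ≠ 0) : ContinuousAt (forceHDeriv lam mu mus) x := by
  have hs := s₁_re_pos hmu hlam hmus hne
  have hs' := s₂_re_pos hmu hlam hmus hne
  have c1 := continuousAt_K₁ hs hx
  have c2 := continuousAt_K₂ hs hx
  have c3 := continuousAt_K₁ hs' hx
  have c4 := continuousAt_K₂ hs' hx
  unfold forceHDeriv
  fun_prop

theorem continuousAt_forceVDeriv (hmu : 0 < mu) (hlam : 0 < lam + mu) (hmus : 0 < mus)
    (hne : mus ≠ mu) {x : ℝ × ℝ} (hx : x ≠ 0) : ContinuousAt (forceVDeriv lam mu mus) x := by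
  have hs := s₁_re_pos hmu hlam hmus hne
  have hs' := s₂_re_pos hmu hlam hmus hne
  have c1 := continuousAt_K₁ hs hx
  have c2 := continuousAt_K₂ hs hx
  have c3 := continuousAt_K₁ hs' hx
  have c4 := continuousAt_K₂ hs' hx
  unfold forceVDeriv
  fun_prop

theorem couple_eq_half_sub (hmu : 0 < mu) (hlam : 0 < lam + mu) (hmus : 0 < mus) (hne : mus ≠ mu)
    (x : ℝ × ℝ) : couple lam mu mus x
      = (1 / 2 : ℝ) • (forceHDeriv lam mu mus x - forceVDeriv lam mu mus x) := by
  have hss := s₁_mul_s₂ hmu hlam hmus hne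
  have hhalf : ∀ z w : ℂ, (1 / 2 : ℝ) * (z.re - w.re) = (1 / 2 * (z - w)).re := by
    intro z w
    rw [← Complex.sub_re, ← Complex.re_ofReal_mul]
    push_cast
    rfl
  refine Prod.ext ?_ ?_
  · change (couple₁ lam mu mus x).re = (1 / 2 : ℝ) * (_ - _)
    rw [forceHDeriv, forceVDeriv, hhalf, couple₁_eq hmu hlam hmus hne, Y1_eq hss,
      Y1_eq ((mul_comm _ _).trans hss)]
    congr 1
    linear_combination (4 * Real.pi * sqrtq lam mu mus : ℂ)⁻¹ * mus
      * (s₁ lam mu mus * K₂ (s₁ lam mu mus) x - s₂ lam mu mus * K₂ (s₂ lam mu mus) x) * hss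
  · change (couple₂ lam mu mus x).re = (1 / 2 : ℝ) * (_ - _)
    rw [forceHDeriv, forceVDeriv, hhalf, couple₂_eq hmu hlam hmus hne, Y2_eq hss,
      Y2_eq ((mul_comm _ _).trans hss)]
    congr 1
    ring

/-- The derivative of `dipoles` with respect to the arm parameter, away from the four forces. -/
def dipolesDeriv (lam mu mus : ℝ) (x : ℝ × ℝ) (d : ℝ) : ℝ × ℝ :=
  (1 / 4 : ℝ) • forceHDeriv lam mu mus (x.1, x.2 + d / 4)
    - (-(1 / 4) : ℝ) • forceHDeriv lam mu mus (x.1, x.2 - d / 4)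
    - (1 / 4 : ℝ) • forceVDeriv lam mu mus (x.1 + d / 4, x.2)
    + (-(1 / 4) : ℝ) • forceVDeriv lam mu mus (x.1 - d / 4, x.2)

theorem hasDerivAt_add_div_four (a d : ℝ) : HasDerivAt (fun d : ℝ => a + d / 4) (1 / 4) d :=
  ((hasDerivAt_id d).div_const 4).const_add a

theorem hasDerivAt_sub_div_four (a d : ℝ) : HasDerivAt (fun d : ℝ => a - d / 4) (-(1 / 4)) d :=
  ((hasDerivAt_id d).div_const 4).const_sub a

theorem hasDerivAt_dipoles (hmu : 0 < mu) (hlam : 0 < lam + mu) (hmus : 0 < mus) (hne : mus ≠ mu)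
    {x : ℝ × ℝ} {d : ℝ} (h1 : (x.1, x.2 + d / 4) ≠ 0) (h2 : (x.1, x.2 - d / 4) ≠ 0)
    (h3 : (x.1 + d / 4, x.2) ≠ 0) (h4 : (x.1 - d / 4, x.2) ≠ 0) :
    HasDerivAt (dipoles lam mu mus x) (dipolesDeriv lam mu mus x d) d :=
  ((((hasDerivAt_forceH hmu hlam hmus hne h1).scomp d (hasDerivAt_add_div_four _ d)).sub
    ((hasDerivAt_forceH hmu hlam hmus hne h2).scomp d (hasDerivAt_sub_div_four _ d))).sub
    ((hasDerivAt_forceV hmu hlam hmus hne h3).scomp d (hasDerivAt_add_div_four _ d))).add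
    ((hasDerivAt_forceV hmu hlam hmus hne h4).scomp d (hasDerivAt_sub_div_four _ d))

theorem eventually_hasDerivAt_dipoles (hmu : 0 < mu) (hlam : 0 < lam + mu) (hmus : 0 < mus)
    (hne : mus ≠ mu) {x : ℝ × ℝ} (hx : x ≠ 0) :
    ∀ᶠ d in 𝓝 (0 : ℝ), HasDerivAt (dipoles lam mu mus x) (dipolesDeriv lam mu mus x d) d := by
  have hev : ∀ c : ℝ → ℝ × ℝ, Continuous c → c 0 = x → ∀ᶠ d in 𝓝 (0 : ℝ), c d ≠ 0 :=
    fun c hc h0 => hc.continuousAt.eventually_ne (by rwa [h0])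
  filter_upwards [hev (fun d => (x.1, x.2 + d / 4)) (by fun_prop) (by simp),
    hev (fun d => (x.1, x.2 - d / 4)) (by fun_prop) (by simp),
    hev (fun d => (x.1 + d / 4, x.2)) (by fun_prop) (by simp),
    hev (fun d => (x.1 - d / 4, x.2)) (by fun_prop) (by simp)] with d h1 h2 h3 h4
  exact hasDerivAt_dipoles hmu hlam hmus hne h1 h2 h3 h4

theorem dipolesDeriv_zero (hmu : 0 < mu) (hlam : 0 < lam + mu) (hmus : 0 < mus)
    (hne : mus ≠ mu) (x : ℝ × ℝ) : dipolesDeriv lam mu mus x 0 = couple lam mu mus x := by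
  rw [couple_eq_half_sub hmu hlam hmus hne, dipolesDeriv]
  simp only [zero_div, add_zero, sub_zero, Prod.mk.eta]
  module

theorem tendsto_dipolesDeriv (hmu : 0 < mu) (hlam : 0 < lam + mu) (hmus : 0 < mus)
    (hne : mus ≠ mu) {x : ℝ × ℝ} (hx : x ≠ 0) :
    Tendsto (dipolesDeriv lam mu mus x) (𝓝 0) (𝓝 (couple lam mu mus x)) := by
  rw [← dipolesDeriv_zero hmu hlam hmus hne]
  have hH : ∀ c : ℝ → ℝ × ℝ, Continuous c → c 0 = x →
      ContinuousAt (fun d => forceHDeriv lam mu mus (c d)) 0 := fun c hc h0 =>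
    (continuousAt_forceHDeriv hmu hlam hmus hne hx).comp_of_eq hc.continuousAt h0
  have hV : ∀ c : ℝ → ℝ × ℝ, Continuous c → c 0 = x →
      ContinuousAt (fun d => forceVDeriv lam mu mus (c d)) 0 := fun c hc h0 =>
    (continuousAt_forceVDeriv hmu hlam hmus hne hx).comp_of_eq hc.continuousAt h0
  have h1 := hH (fun d => (x.1, x.2 + d / 4)) (by fun_prop) (by simp)
  have h2 := hH (fun d => (x.1, x.2 - d / 4)) (by fun_prop) (by simp)
  have h3 := hV (fun d => (x.1 + d / 4, x.2)) (by fun_prop) (by simp)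
  have h4 := hV (fun d => (x.1 - d / 4, x.2)) (by fun_prop) (by simp)
  change ContinuousAt (fun d => dipolesDeriv lam mu mus x d) 0
  unfold dipolesDeriv
  exact (((h1.const_smul (1 / 4 : ℝ)).sub (h2.const_smul (-(1 / 4) : ℝ))).sub
    (h3.const_smul (1 / 4 : ℝ))).add (h4.const_smul (-(1 / 4) : ℝ))

/-! ### The isotropic limit -/

theorem rootSum_self (hmu : 0 < mu) (hlam : 0 < lam + mu) : rootSum lam mu mu = 2 := by
  have : 0 < lam + 2 * mu := by linarith
  rw [rootSum, div_eq_iff (by positivity)]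
  ring

theorem coupleDenom_self (hmu : 0 < mu) (hlam : 0 < lam + mu) (x : ℝ × ℝ) :
    coupleDenom lam mu mu x
      = 4 * Real.pi * mu * (x.1 ^ 2 + x.2 ^ 2) * (2 * (lam + 2 * mu) * (x.1 ^ 2 + x.2 ^ 2)) := by
  have h4 : √(2 + 2 : ℝ) = 2 := by
    rw [show (2 + 2 : ℝ) = 2 ^ 2 by norm_num, Real.sqrt_sq zero_le_two]
  rw [coupleDenom, rootSum_self hmu hlam, h4]
  ring

theorem coupleReal_self (hmu : 0 < mu) (hlam : 0 < lam + mu) {x : ℝ × ℝ} (hx : x ≠ 0) :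
    coupleReal lam mu mu x = isoCouple mu x := by
  have hr := (sq_add_sq_pos hx).ne'
  have hC : lam + 2 * mu ≠ 0 := by linarith
  have hfac : 2 * (lam + 2 * mu) * (x.1 ^ 2 + x.2 ^ 2) ≠ 0 := by positivity
  rw [coupleReal, isoCouple, rootSum_self hmu hlam, coupleDenom_self hmu hlam]
  refine Prod.ext ?_ ?_
  · rw [← mul_div_mul_right (-x.2) _ hfac]
    ring
  · rw [← mul_div_mul_right x.1 _ hfac]
    ring

theorem continuousAt_coupleReal (hmu : 0 < mu) (hlam : 0 < lam + mu) {x : ℝ × ℝ} (hx : x ≠ 0) :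
    ContinuousAt (fun mus => coupleReal lam mu mus x) mu := by
  have hr := sq_add_sq_pos hx
  have hC : 0 < lam + 2 * mu := by linarith
  have hroot : ContinuousAt (fun mus => rootSum lam mu mus) mu :=
    ContinuousAt.div (by fun_prop) (by fun_prop) (by positivity)
  have hden : ContinuousAt (fun mus => coupleDenom lam mu mus x) mu := by
    unfold coupleDenom
    fun_prop
  have hden0 : coupleDenom lam mu mu x ≠ 0 := by
    rw [coupleDenom_self hmu hlam]
    have := Real.pi_pos
    positivity
  exact ContinuousAt.prodMk (ContinuousAt.div (by fun_prop) hden hden0)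
    (ContinuousAt.div (by fun_prop) hden hden0)

theorem tendsto_couple_isoCouple (hmu : 0 < mu) (hlam : 0 < lam + mu) {x : ℝ × ℝ} (hx : x ≠ 0) :
    Tendsto (fun mus => couple lam mu mus x) (𝓝[≠] mu) (𝓝 (isoCouple mu x)) := by
  rw [← coupleReal_self hmu hlam hx]
  refine ((continuousAt_coupleReal hmu hlam hx).tendsto.mono_left nhdsWithin_le_nhds).congr' ?_
  filter_upwards [self_mem_nhdsWithin, nhdsWithin_le_nhds (lt_mem_nhds hmu)] with mus hne hmus
  exact (couple_eq_coupleReal hmu hlam hmus hne x).symm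

/-- Both characteristic roots are `1`, and the field is a rotated gradient of `log r / (4 π μ)`. -/
theorem isUnitCoupleSolution_isoCouple (hmu : 0 < mu) :
    IsUnitCoupleSolution lam mu mu (isoCouple mu) := by
  have hs : 0 < (1 : ℂ).re := by simp
  have hm : (mu : ℂ) ≠ 0 := by exact_mod_cast hmu.ne'
  have hc : (4 * Real.pi * mu : ℂ)⁻¹ * (4 * Real.pi * mu) = 1 :=
    inv_mul_cancel₀ (four_pi_mul_ne_zero hm)
  refine isEquilibrium_of_complex (U := fun x => -(4 * Real.pi * mu : ℂ)⁻¹ * K₂ 1 x)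
    (V := fun x => (4 * Real.pi * mu : ℂ)⁻¹ * K₁ 1 x) (fun x => ?_) (fun x => ?_)
    ((locallyIntegrable_K₂ hs).smul (-(4 * Real.pi * mu : ℂ)⁻¹))
    ((locallyIntegrable_K₁ hs).smul ((4 * Real.pi * mu : ℂ)⁻¹)) (fun φ t => ?_) (fun φ t => ?_)
  · simp only [K₂, isoCouple, rsq]
    push_cast
    rw [div_mul_eq_div_div]
    ring
  · simp only [K₁, isoCouple, rsq]
    push_cast
    rw [div_mul_eq_div_div]
    ring
  · have hflux := integral_K₁_mul_D₁_add_K₂_mul_D₂ hs t.isTest_D₂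
    have hcross := integral_K₁_mul_D₂ hs t.isTest_D₁
    simp only [← t.D₁_D₂] at hcross
    simp only [mul_assoc _ (K₂ 1 _), mul_assoc _ (K₁ 1 _), integral_const_mul]
    push_cast
    linear_combination (4 * Real.pi * mu : ℂ)⁻¹ * (lam + 2 * mu) * hcross
      - (4 * Real.pi * mu : ℂ)⁻¹ * mu * hflux + 1 / 2 * D₂ φ 0 * hc
  · have hflux := integral_K₁_mul_D₁_add_K₂_mul_D₂ hs t.isTest_D₁
    have hcross := integral_K₁_mul_D₂ hs t.isTest_D₂
    simp only [← t.D₁_D₂] at hflux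
    simp only [mul_assoc _ (K₂ 1 _), mul_assoc _ (K₁ 1 _), integral_const_mul]
    push_cast
    linear_combination (4 * Real.pi * mu : ℂ)⁻¹ * (lam + 2 * mu) * hcross
      + (4 * Real.pi * mu : ℂ)⁻¹ * mu * hflux - 1 / 2 * D₁ φ 0 * hc

end CubicCouple

end

open CubicCouple in
theorem mainTheorem2 (lam mu : ℝ) (hmu : 0 < mu) (hlam : 0 < lam + mu) :
    (∀ mus : ℝ, 0 < mus → mus ≠ mu →
      -- the concentrated force fields are real and are the Green's functions of the material
      (∀ P : ℝ,
        (∀ x : ℝ × ℝ,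
          forceH₁ lam mu mus P x = ((forceH lam mu mus P x).1 : ℂ) ∧
          forceH₂ lam mu mus P x = ((forceH lam mu mus P x).2 : ℂ) ∧
          forceV₁ lam mu mus P x = ((forceV lam mu mus P x).1 : ℂ) ∧
          forceV₂ lam mu mus P x = ((forceV lam mu mus P x).2 : ℂ)) ∧
        IsForceSolution lam mu mus P 0 (forceH lam mu mus P) ∧
        IsForceSolution lam mu mus 0 P (forceV lam mu mus P)) ∧
      -- the explicit couple field is real and is the derivative with respect to the dipole arm
      (∀ x : ℝ × ℝ, x ≠ 0 →
        couple₁ lam mu mus x = ((couple lam mu mus x).1 : ℂ) ∧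
        couple₂ lam mu mus x = ((couple lam mu mus x).2 : ℂ) ∧
        HasDerivAt (dipoles lam mu mus x) (couple lam mu mus x) 0 ∧
        (∀ᶠ d in 𝓝 (0 : ℝ), DifferentiableAt ℝ (dipoles lam mu mus x) d) ∧
        Tendsto (deriv (dipoles lam mu mus x)) (𝓝[≠] 0) (𝓝 (couple lam mu mus x))) ∧
      -- it is a displacement field of the unit concentrated couple
      IsUnitCoupleSolution lam mu mus (couple lam mu mus)) ∧
    -- the isotropic limit
    (∀ x : ℝ × ℝ, x ≠ 0 →
      Tendsto (fun mus => couple lam mu mus x) (𝓝[≠] mu) (𝓝 (isoCouple mu x))) ∧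
    IsUnitCoupleSolution lam mu mu (isoCouple mu) := by
  refine ⟨fun mus hmus hne => ⟨fun P => ⟨fun x => ⟨?_, ?_, ?_, ?_⟩, ?_, ?_⟩, fun x hx => ?_, ?_⟩,
    fun x hx => tendsto_couple_isoCouple hmu hlam hx, isUnitCoupleSolution_isoCouple hmu⟩
  · exact forceH₁_eq_ofReal hmu hlam hmus hne P x
  · exact forceH₂_eq_ofReal hmu hlam hmus hne P x
  · exact forceV₁_eq_ofReal hmu hlam hmus hne P x
  · exact forceV₂_eq_ofReal hmu hlam hmus hne P x
  · exact isForceSolution_forceH hmu hlam hmus hne P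
  · exact isForceSolution_forceV hmu hlam hmus hne P
  · have hev := eventually_hasDerivAt_dipoles hmu hlam hmus hne hx
    refine ⟨couple₁_eq_ofReal hmu hlam hmus hne x, couple₂_eq_ofReal hmu hlam hmus hne x, ?_,
      hev.mono fun d hd => hd.differentiableAt, ?_⟩
    · rw [← dipolesDeriv_zero hmu hlam hmus hne]
      exact hev.self_of_nhds
    · refine ((tendsto_dipolesDeriv hmu hlam hmus hne hx).congr' ?_).mono_left nhdsWithin_le_nhds
      exact hev.mono fun d hd => hd.deriv.symm
  · exact isUnitCoupleSolution_couple hmu hlam hmus hne
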